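/- Let $r\le n$ and $E=\{1,\dots,n\}$. For an $r\times n$ matrix $A=(a_{i,j})$ with entries in $\{+1,-1\}$ let $\mathcal M_A$ be the uniform oriented matroid of rank $r$ on $E$ whose chirotope is $\chi(j_1,\dots,j_r)=\prod_{i=1}^r a_{i,j_i}$ for $j_1<\dots<j_r$; the oriented matroids $\mathcal M_A$ are the Lawrence oriented matroids (LOMs) of rank $r$ on $n$ elements. The alternating oriented matroid $C_r(n)$ is the uniform oriented matroid of rank $r$ on $E$ all of whose circuits alternate in sign along the order of $E$. For $R\subseteq E$ the reorientation ${}_{-R}\mathcal M$ of an oriented matroid $\mathcal M$ is obtained by reversing the signs of the elements of $R$ in all circuits, and $[\mathcal M]=\{{}_{-R}\mathcal M : R\subseteq E\}$ is the reorientation class of $\mathcal M$. An oriented matroid is $k$-neighborly if each of its circuits has more than $k$ positive and more than $k$ negative elements. Let $f_{\mathcal M}(r,n,k)$ be the number of subsets $R\subseteq E$ such that ${}_{-R}\mathcal M$ is $k$-neighborly, and let $c_r(n,k)=f_{C_r(n)}(r,n,k)$. **Theorem.** Let $\mathcal M$ range over the rank $8$ LOMs on $n$ elements with $\mathcal M\notin[C_8(n)]$.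 (a) If $n=11$, then $f_{\mathcal M}(8,11,2)\le c_8(11,2)$ for all such $\mathcal M$, and there are exactly $255$ reorientation classes $[\mathcal M]$ of such $\mathcal M$ with $f_{\mathcal M}(8,11,2)=c_8(11,2)$. (b) If $n=11$, then $f_{\mathcal M}(8,11,3)\le c_8(11,3)$ for all such $\mathcal M$, and there are exactly $255$ reorientation classes $[\mathcal M]$ of such $\mathcal M$ with $f_{\mathcal M}(8,11,3)=c_8(11,3)$. (c) If $n=12$, then $f_{\mathcal M}(8,12,2)\le c_8(12,2)$ for all such $\mathcal M$, and there are exactly $511$ reorientation classes $[\mathcal M]$ of such $\mathcal M$ with $f_{\mathcal M}(8,12,2)=c_8(12,2)$. (d) If $n=12$, then $f_{\mathcal M}(8,12,3)\le c_8(12,3)$ for all such $\mathcal M$, and there are exactly $511$ reorientation classes $[\mathcal M]$ of such $\mathcal M$ with $f_{\mathcal M}(8,12,3)=c_8(12,3)$. -/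

import Mathlib

/-- An oriented matroid on the ground set `E`, given by its circuits: the signed subsets of `E` are
the maps `E → SignType`, and `circuits` satisfies the circuit axioms (non-emptiness, symmetry,
incomparability, weak elimination). -/
@[ext]
structure OrientedMatroid (E : Type*) where
  circuits : Set (E → SignType)
  zero_notMem : (0 : E → SignType) ∉ circuits
  neg_mem : ∀ X ∈ circuits, -X ∈ circuits
  eq_or_eq_neg : ∀ X ∈ circuits, ∀ Y ∈ circuits,
    (∀ e, X e ≠ 0 → Y e ≠ 0) → X = Y ∨ X = -Y
  elimination : ∀ X ∈ circuits, ∀ Y ∈ circuits, X ≠ -Y → ∀ e, X e = 1 → Y e = -1 →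
    ∃ Z ∈ circuits, Z e = 0 ∧ (∀ f, Z f = 1 → X f = 1 ∨ Y f = 1) ∧
      (∀ f, Z f = -1 → X f = -1 ∨ Y f = -1)

namespace OrientedMatroid

section General

variable {E : Type*} [DecidableEq E]

/-- Reverse the signs of the elements of `R` in the signed set `X`. -/
def reorientVec (R : Finset E) (X : E → SignType) : E → SignType :=
  fun e => if e ∈ R then -X e else X e

theorem reorientVec_neg (R : Finset E) (X : E → SignType) :
    reorientVec R (-X) = -reorientVec R X := by
  funext e; by_cases h : e ∈ R <;> simp [reorientVec, h]

theorem reorientVec_ne_zero (R : Finset E) (X : E → SignType) (e : E) :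
    reorientVec R X e ≠ 0 ↔ X e ≠ 0 := by
  by_cases h : e ∈ R <;> simp [reorientVec, h]

/-- The reorientation of `M` on `R`. -/
def reorient (M : OrientedMatroid E) (R : Finset E) : OrientedMatroid E where
  circuits := reorientVec R '' M.circuits
  zero_notMem := by
    rintro ⟨X, hX, h⟩
    refine M.zero_notMem ?_
    have : X = 0 := by
      funext e
      by_contra hne
      exact (reorientVec_ne_zero R X e).2 hne (congrFun h e)
    exact this ▸ hX
  neg_mem := by
    rintro _ ⟨X, hX, rfl⟩
    exact ⟨-X, M.neg_mem X hX, reorientVec_neg R X⟩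
  eq_or_eq_neg := by
    rintro _ ⟨X, hX, rfl⟩ _ ⟨Y, hY, rfl⟩ h
    rcases M.eq_or_eq_neg X hX Y hY
      (fun e he => (reorientVec_ne_zero R Y e).1 (h e ((reorientVec_ne_zero R X e).2 he)))
      with rfl | rfl
    · exact Or.inl rfl
    · exact Or.inr (reorientVec_neg R Y)
  elimination := by
    rintro _ ⟨X, hX, rfl⟩ _ ⟨Y, hY, rfl⟩ hne e he1 he2
    have hne' : X ≠ -Y := by
      rintro rfl
      exact hne (reorientVec_neg R Y)
    by_cases h : e ∈ R
    · simp only [reorientVec, h, if_true] at he1 he2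
      have hx : X e = -1 := by rw [← he1, neg_neg]
      have hy : Y e = 1 := by rw [← neg_neg (Y e), he2, neg_neg]
      obtain ⟨Z, hZ, h0, h1, h2⟩ := M.elimination Y hY X hX
        (by rintro rfl; exact hne' (neg_neg X).symm) e hy hx
      refine ⟨_, ⟨Z, hZ, rfl⟩, by simp [reorientVec, h0], fun f hf => ?_, fun f hf => ?_⟩ <;>
      · have a1 := h1 f
        have a2 := h2 f
        simp only [reorientVec] at hf ⊢
        revert a1 a2 hf
        generalize X f = u
        generalize Y f = v
        generalize Z f = w
        split_ifs <;> revert u v w <;> decide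
    · simp only [reorientVec, h, if_false] at he1 he2
      obtain ⟨Z, hZ, h0, h1, h2⟩ := M.elimination X hX Y hY hne' e he1 he2
      refine ⟨_, ⟨Z, hZ, rfl⟩, by simp [reorientVec, h0], fun f hf => ?_, fun f hf => ?_⟩ <;>
      · have a1 := h1 f
        have a2 := h2 f
        simp only [reorientVec] at hf ⊢
        revert a1 a2 hf
        generalize X f = u
        generalize Y f = v
        generalize Z f = w
        split_ifs <;> revert u v w <;> decide

/-- The reorientation class `[M]`. -/
def reorientationClass (M : OrientedMatroid E) : Set (OrientedMatroid E) :=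
  Set.range M.reorient

variable [Fintype E]

/-- `M` is `k`-neighborly: every circuit has more than `k` positive and more than `k` negative
elements. -/
def IsNeighborly (M : OrientedMatroid E) (k : ℕ) : Prop :=
  ∀ X ∈ M.circuits, k < (Finset.univ.filter fun e => X e = 1).card ∧
    k < (Finset.univ.filter fun e => X e = -1).card

/-- The number of `k`-neighborly reorientations of `M`, that is, the number of subsets `R` of the
ground set whose reorientation makes `M` `k`-neighborly. -/
noncomputable def numNeighborly (M : OrientedMatroid E) (k : ℕ) : ℕ :=
  {R : Finset E | (M.reorient R).IsNeighborly k}.ncard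

end General

section Lawrence

/-- The sign `∏ i, a (i, j_i)` of the ordered basis `j_1 < ⋯ < j_r` in the Lawrence oriented matroid
of the sign matrix `A`. -/
def basisSign {r n : ℕ} (A : Matrix (Fin r) (Fin n) ℤˣ) (b : Fin r ↪o Fin n) : ℤˣ :=
  ∏ i, A i (b i)

/-- The circuits of the Lawrence oriented matroid of `A`. The supports are the sets
`{j_0 < ⋯ < j_r}` of `r + 1` elements, and the signs are determined, up to a global sign, by the
chirotope: `χ (J \ j_i) = - X (j_i) * X (j_{i+1}) * χ (J \ j_{i+1})`. -/
def lawrenceCircuits {r n : ℕ} (A : Matrix (Fin r) (Fin n) ℤˣ) : Set (Fin n → SignType) :=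
  {X | ∃ J : Fin (r + 1) ↪o Fin n, (∀ e, X e ≠ 0 ↔ e ∈ Set.range J) ∧
    ∀ i : Fin r, (basisSign A ((Fin.succAboveOrderEmb i.castSucc).trans J) : ℤ) =
      -(X (J i.castSucc) : ℤ) * (X (J i.succ) : ℤ) *
        (basisSign A ((Fin.succAboveOrderEmb i.succ).trans J) : ℤ)}

theorem basisSign_mul {r n : ℕ} (A : Matrix (Fin r) (Fin n) ℤˣ) (J : Fin (r + 1) ↪o Fin n)
    (i : Fin r) :
    basisSign A ((Fin.succAboveOrderEmb i.castSucc).trans J) * A i (J i.castSucc) =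
      basisSign A ((Fin.succAboveOrderEmb i.succ).trans J) * A i (J i.succ) := by
  unfold basisSign
  rw [← Finset.mul_prod_erase _ _ (Finset.mem_univ i), ← Finset.mul_prod_erase _
    (fun l => A l (((Fin.succAboveOrderEmb i.succ).trans J) l)) (Finset.mem_univ i)]
  have h : ∏ l ∈ Finset.univ.erase i, A l (((Fin.succAboveOrderEmb i.castSucc).trans J) l) =
      ∏ l ∈ Finset.univ.erase i, A l (((Fin.succAboveOrderEmb i.succ).trans J) l) := by
    refine Finset.prod_congr rfl fun l hl => ?_
    have hl' : l ≠ i := (Finset.mem_erase.1 hl).1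
    have : i.castSucc.succAbove l = i.succ.succAbove l := by
      rcases lt_or_gt_of_ne hl' with h | h
      · rw [Fin.succAbove_of_castSucc_lt _ _ (by simpa using h),
          Fin.succAbove_of_castSucc_lt _ _ (by
            rw [Fin.lt_def] at *; simp; omega)]
      · rw [Fin.succAbove_of_le_castSucc _ _ (by
            rw [Fin.le_def]; rw [Fin.lt_def] at h; simp; omega),
          Fin.succAbove_of_le_castSucc _ _ (by
            rw [Fin.le_def]; rw [Fin.lt_def] at h; simp; omega)]
    simp [this]
  rw [h]
  simp only [RelEmbedding.coe_trans, Function.comp_apply, Fin.succAboveOrderEmb_apply,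
    Fin.succAbove_castSucc_self, Fin.succAbove_succ_self]
  rw [mul_right_comm, mul_comm (A i (J i.succ)), mul_right_comm]

/-- The sign of a unit of `ℤ`. -/
def unitSign (u : ℤˣ) : SignType := if u = 1 then 1 else -1

theorem unitSign_cases (u : ℤˣ) : (u = 1 ∧ unitSign u = 1) ∨ (u = -1 ∧ unitSign u = -1) := by
  rcases Int.units_eq_one_or u with rfl | rfl
  · left; simp [unitSign]
  · right; simp [unitSign]

theorem units_ne {u v : ℤˣ} (h : u ≠ v) : u = -v := by
  rcases Int.units_eq_one_or u with rfl | rfl <;> rcases Int.units_eq_one_or v with rfl | rfl <;>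
    simp_all

theorem mem_lawrenceCircuits {r n : ℕ} (A : Matrix (Fin r) (Fin n) ℤˣ) (X : Fin n → SignType) :
    X ∈ lawrenceCircuits A ↔ ∃ (J : Fin (r + 1) ↪o Fin n) (s : Fin (r + 1) → ℤˣ),
      (∀ i, X (J i) = unitSign (s i)) ∧ (∀ e, e ∉ Set.range J → X e = 0) ∧
      ∀ i : Fin r, s i.succ * A i (J i.succ) = -(s i.castSucc * A i (J i.castSucc)) := by
  have key : ∀ (u v c d a b : ℤˣ), c * a = d * b →
      ((c : ℤ) = -(unitSign u : ℤ) * (unitSign v : ℤ) * (d : ℤ) ↔ v * b = -(u * a)) := by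
    intro u v c d a b
    rcases unitSign_cases u with ⟨rfl, h1⟩ | ⟨rfl, h1⟩ <;>
    rcases unitSign_cases v with ⟨rfl, h2⟩ | ⟨rfl, h2⟩ <;>
    simp only [h1, h2] <;>
    rcases Int.units_eq_one_or a with rfl | rfl <;>
    rcases Int.units_eq_one_or b with rfl | rfl <;>
    rcases Int.units_eq_one_or c with rfl | rfl <;>
    rcases Int.units_eq_one_or d with rfl | rfl <;> decide
  constructor
  · rintro ⟨J, hs, hJ⟩
    have : ∀ i, ∃ u : ℤˣ, X (J i) = unitSign u := by
      intro i
      have h0 : X (J i) ≠ 0 := (hs _).2 ⟨i, rfl⟩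
      rcases h : X (J i) with _ | _ | _
      · exact absurd h h0
      · exact ⟨-1, by simp [unitSign]⟩
      · exact ⟨1, by simp [unitSign]⟩
    choose s hsg using this
    refine ⟨J, s, hsg, fun e he => ?_, fun i => ?_⟩
    · by_contra h
      exact he ((hs e).1 h)
    · have := hJ i
      rw [hsg, hsg] at this
      exact (key _ _ _ _ _ _ (basisSign_mul A J i)).1 this
  · rintro ⟨J, s, h1, h2, h3⟩
    refine ⟨J, fun e => ⟨fun h => ?_, ?_⟩, fun i => ?_⟩
    · by_contra he
      exact h (h2 e he)
    · rintro ⟨i, rfl⟩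
      rw [h1]
      rcases unitSign_cases (s i) with ⟨-, h⟩ | ⟨-, h⟩ <;> rw [h] <;> decide
    · rw [h1, h1]
      exact (key _ _ _ _ _ _ (basisSign_mul A J i)).2 (h3 i)

/-- `Reach a P m j s`: some sequence `j_0 < ⋯ < j_m = j` with signs `s_0, …, s_m = s` allowed by `P`
satisfies the sign rule for circuits of the matrix `a`. An auxiliary notion for the proof of the
elimination axiom. -/
inductive Reach {α : Type*} [LinearOrder α] (a : ℕ → α → ℤˣ) (P : α → ℤˣ → Prop) :
    ℕ → α → ℤˣ → Prop
  | base {j : α} {s : ℤˣ} : P j s → Reach a P 0 j s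
  | step {m : ℕ} {j j' : α} {s s' : ℤˣ} : Reach a P m j s → j < j' → P j' s' →
      s' * a m j' = -(s * a m j) → Reach a P (m + 1) j' s'

theorem Reach.exists_path {α : Type*} [LinearOrder α] {a : ℕ → α → ℤˣ} {P : α → ℤˣ → Prop}
    {m : ℕ} {j : α} {s : ℤˣ} (h : Reach a P m j s) :
    ∃ (z : ℕ → α) (w : ℕ → ℤˣ), z m = j ∧ w m = s ∧ (∀ i < m, z i < z (i + 1)) ∧
      (∀ i < m, w (i + 1) * a i (z (i + 1)) = -(w i * a i (z i))) ∧ ∀ i ≤ m, P (z i) (w i) := by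
  induction h with
  | @base j s h => exact ⟨fun _ => j, fun _ => s, rfl, rfl, by simp, by simp, by simpa using h⟩
  | @step m j j' s s' _ hlt hP hs ih =>
    obtain ⟨z, w, hz, hw, h1, h2, h3⟩ := ih
    refine ⟨fun i => if i ≤ m then z i else j', fun i => if i ≤ m then w i else s',
      by simp, by simp, fun i hi => ?_, fun i hi => ?_, fun i hi => ?_⟩
    · rcases Nat.lt_succ_iff_lt_or_eq.1 hi with h | rfl
      · simpa [h.le, Nat.succ_le_of_lt h] using h1 i h
      · simpa [hz] using hlt
    · rcases Nat.lt_succ_iff_lt_or_eq.1 hi with h | rfl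
      · simpa [h.le, Nat.succ_le_of_lt h] using h2 i h
      · simpa [hz, hw] using hs
    · rcases Nat.le_succ_iff.1 hi with h | rfl
      · simpa [h] using h3 i h
      · simpa using hP

section Elim

variable {α : Type*} [LinearOrder α] {a : ℕ → α → ℤˣ} {P : α → ℤˣ → Prop} {r : ℕ} {e : α}

/-- `(x, σ)` is a signed path whose points other than `e` are allowed by `P`. -/
structure IsPath (a : ℕ → α → ℤˣ) (P : α → ℤˣ → Prop) (r : ℕ) (e : α) (x : ℕ → α)
    (σ : ℕ → ℤˣ) : Prop where
  lt : ∀ i < r, x i < x (i + 1)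
  rule : ∀ i < r, σ (i + 1) * a i (x (i + 1)) = -(σ i * a i (x i))
  allowed : ∀ i ≤ r, x i ≠ e → P (x i) (σ i)

theorem IsPath.mono {x : ℕ → α} {σ : ℕ → ℤˣ} (h : IsPath a P r e x σ) {i j : ℕ} (hij : i < j)
    (hj : j ≤ r) : x i < x j := by
  induction j, hij using Nat.le_induction with
  | base => exact h.lt i (by omega)
  | succ j hij ih => exact (ih (by omega)).trans (h.lt j (by omega))

theorem value_cases {u v w : ℤˣ} (h : u = -v) : w = u ∨ w = v := by
  rcases Int.units_eq_one_or u with rfl | rfl <;> rcases Int.units_eq_one_or v with rfl | rfl <;>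
    rcases Int.units_eq_one_or w with rfl | rfl <;> simp_all

/-- Having reached a point at or before the `i`-th point of a path, one can follow the path to its
end. -/
theorem IsPath.follow {x : ℕ → α} {σ : ℕ → ℤˣ} (h : IsPath a P r e x σ) {i m : ℕ} (him : i ≤ m)
    (hm : m ≤ r) (hne : ∀ l, i ≤ l → l ≤ m → x l ≠ e)
    (h0 : ∃ j s, Reach a P i j s ∧ (j < x i ∨ (j = x i ∧ s = σ i))) :
    ∃ j s, Reach a P m j s ∧ (j < x m ∨ (j = x m ∧ s = σ m)) := by
  induction m, him using Nat.le_induction with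
  | base => exact h0
  | succ m him ih =>
    obtain ⟨j, s, hR, hj⟩ := ih (by omega) fun l h1 h2 => hne l h1 (by omega)
    have hlt := h.lt m (by omega)
    have hr := h.rule m (by omega)
    have ha1 := h.allowed m (by omega) (hne m him (by omega))
    have ha2 := h.allowed (m + 1) hm (hne (m + 1) (by omega) le_rfl)
    rcases hj with hj | ⟨rfl, rfl⟩
    · rcases value_cases (w := -(s * a m j)) hr with hv | hv
      · exact ⟨_, _, hR.step (hj.trans hlt) ha2 hv.symm, Or.inr ⟨rfl, rfl⟩⟩
      · exact ⟨_, _, hR.step hj ha1 hv.symm, Or.inl hlt⟩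
    · exact ⟨_, _, hR.step hlt ha2 hr, Or.inr ⟨rfl, rfl⟩⟩

theorem IsPath.prefix_reach {x : ℕ → α} {σ : ℕ → ℤˣ} (h : IsPath a P r e x σ) {m : ℕ}
    (hm : m ≤ r) (hne : ∀ l ≤ m, x l ≠ e) : Reach a P m (x m) (σ m) := by
  induction m with
  | zero => exact .base (h.allowed 0 hm (hne 0 le_rfl))
  | succ m ih =>
    exact (ih (by omega) fun l hl => hne l (by omega)).step (h.lt m (by omega))
      (h.allowed _ hm (hne _ le_rfl)) (h.rule m (by omega))

theorem elim_lt {x y : ℕ → α} {σ τ : ℕ → ℤˣ} (hx : IsPath a P r e x σ) (hy : IsPath a P r e y τ)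
    {p q : ℕ} (hq : q ≤ r) (hpq : p < q) (xe : x p = e) (ye : y q = e) (opp : σ p = -τ q) :
    ∃ j s, Reach a P r j s := by
  obtain ⟨t, rfl⟩ : ∃ t, q = t + 1 := ⟨q - 1, by omega⟩
  have hxne : ∀ l, p < l → l ≤ r → x l ≠ e := fun l h1 h2 => xe ▸ (hx.mono h1 h2).ne'
  have hyne : ∀ l, l < t + 1 → y l ≠ e := fun l h1 => ye ▸ (hy.mono h1 hq).ne
  suffices ∃ j s, Reach a P (t + 1) j s ∧ (j < x (t + 1) ∨ (j = x (t + 1) ∧ s = σ (t + 1))) by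
    obtain ⟨j, s, h, -⟩ := hx.follow hq le_rfl (fun l h1 h2 => hxne l (by omega) h2) this
    exact ⟨j, s, h⟩
  obtain ⟨j, s, hR, hj⟩ := hy.follow (m := t) (Nat.zero_le t) (by omega)
    (fun l _ h2 => hyne l (by omega))
    ⟨_, _, hy.prefix_reach (Nat.zero_le r) (fun l hl => hyne l (by omega)), Or.inr ⟨rfl, rfl⟩⟩
  have hyt : y t < e := ye ▸ hy.lt t (by omega)
  have hje : j < e := by
    rcases hj with hj | ⟨rfl, -⟩
    · exact hj.trans hyt
    · exact hyt
  have hxr := hx.rule t (by omega)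
  have hxlt := hx.lt t (by omega)
  have hxa := hx.allowed (t + 1) hq (hxne _ (by omega) hq)
  rcases Nat.lt_succ_iff_lt_or_eq.1 hpq with hpt | rfl
  · have hext : e < x t := xe ▸ hx.mono hpt (by omega)
    rcases value_cases (w := -(s * a t j)) hxr with hv | hv
    · exact ⟨_, _, hR.step ((hje.trans hext).trans hxlt) hxa hv.symm, Or.inr ⟨rfl, rfl⟩⟩
    · exact ⟨_, _, hR.step (hje.trans hext) (hx.allowed t (by omega) hext.ne') hv.symm,
        Or.inl hxlt⟩
  · rw [xe] at hxlt
    have hyr := hy.rule p (by omega)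
    by_cases hv : σ (p + 1) * a p (x (p + 1)) = -(s * a p j)
    · exact ⟨_, _, hR.step (hje.trans hxlt) hxa hv, Or.inr ⟨rfl, rfl⟩⟩
    · have hv' : τ p * a p (y p) = -(s * a p j) := by
        rw [xe, opp] at hxr
        rw [ye] at hyr
        have e1 := units_ne hv
        rw [hxr] at e1
        rw [← neg_eq_iff_eq_neg.2 hyr]
        simpa using e1
      rcases hj with hj | ⟨rfl, rfl⟩
      · exact ⟨_, _, hR.step hj (hy.allowed p (by omega) (hyne p (by omega))) hv',
          Or.inl (hyt.trans hxlt)⟩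
      · exact absurd hv' (by
          rcases Int.units_eq_one_or (τ p * a p (y p)) with h | h <;> rw [h] <;> decide)

theorem Reach.cross {m : ℕ} {u v : α} {s t : ℤˣ} (hu : Reach a P m u s) (hv : Reach a P m v t)
    (pu : P u s) (pv : P v t) (h : s * a m u = -(t * a m v)) (hne : ¬(u = v ∧ s = -t)) :
    (u < v ∧ Reach a P (m + 1) v t) ∨ (v < u ∧ Reach a P (m + 1) u s) := by
  rcases lt_trichotomy u v with huv | rfl | huv
  · exact Or.inl ⟨huv, hu.step huv pv (by rw [h, neg_neg])⟩
  · refine absurd ⟨rfl, ?_⟩ hne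
    rw [← neg_mul] at h
    exact mul_right_cancel h
  · exact Or.inr ⟨huv, hv.step huv pu h⟩

theorem elim_eq {x y : ℕ → α} {σ τ : ℕ → ℤˣ} (hx : IsPath a P r e x σ) (hy : IsPath a P r e y τ)
    {p : ℕ} (hp : p ≤ r) (xe : x p = e) (ye : y p = e) (opp : σ p = -τ p)
    (hne : ∃ i ≤ r, ¬(x i = y i ∧ σ i = -τ i)) : ∃ j s, Reach a P r j s := by
  have hxb : ∀ l, l < p → x l ≠ e := fun l h1 => xe ▸ (hx.mono h1 hp).ne
  have hyb : ∀ l, l < p → y l ≠ e := fun l h1 => ye ▸ (hy.mono h1 hp).ne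
  have hxa : ∀ l, p < l → l ≤ r → x l ≠ e := fun l h1 h2 => xe ▸ (hx.mono h1 h2).ne'
  have hya : ∀ l, p < l → l ≤ r → y l ≠ e := fun l h1 h2 => ye ▸ (hy.mono h1 h2).ne'
  -- a point of the common opposite part is allowed with both signs
  have both : ∀ l ≤ r, l ≠ p → (x l = y l ∧ σ l = -τ l) → ∀ s, P (x l) s := by
    intro l hl hlp hD s
    have h1 : x l ≠ e := by
      rcases lt_or_gt_of_ne hlp with h | h
      · exact hxb l h
      · exact hxa l h hl
    have h2 := hy.allowed l hl (hD.1 ▸ h1)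
    rw [← hD.1] at h2
    by_cases hs : s = σ l
    · exact hs ▸ hx.allowed l hl h1
    · have : s = τ l := by rw [units_ne hs, hD.2, neg_neg]
      exact this ▸ h2
  by_cases hA : ∃ i < p, ¬(x i = y i ∧ σ i = -τ i)
  · -- the paths are not opposite before `e`
    suffices ∃ j s, Reach a P p j s ∧ j < e by
      obtain ⟨j, s, hR, hj⟩ := this
      rcases hp.eq_or_lt with rfl | hpr
      · exact ⟨j, s, hR⟩
      have hxr := hx.rule p hpr
      have hyr := hy.rule p hpr
      have hxlt := hx.lt p hpr
      have hylt := hy.lt p hpr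
      rw [xe] at hxr hxlt
      rw [ye] at hyr hylt
      rw [opp, neg_mul, neg_neg, ← neg_eq_iff_eq_neg.2 hyr] at hxr
      rcases value_cases (w := -(s * a p j)) hxr with hv | hv
      · obtain ⟨j, s, h, -⟩ := hx.follow (Nat.succ_le_of_lt hpr) le_rfl
          (fun l h1 h2 => hxa l (by omega) h2) ⟨_, _, hR.step (hj.trans hxlt)
            (hx.allowed _ (by omega) (hxa _ (by omega) (by omega))) hv.symm, Or.inr ⟨rfl, rfl⟩⟩
        exact ⟨j, s, h⟩
      · obtain ⟨j, s, h, -⟩ := hy.follow (Nat.succ_le_of_lt hpr) le_rfl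
          (fun l h1 h2 => hya l (by omega) h2) ⟨_, _, hR.step (hj.trans hylt)
            (hy.allowed _ (by omega) (hya _ (by omega) (by omega))) hv.symm, Or.inr ⟨rfl, rfl⟩⟩
        exact ⟨j, s, h⟩
    classical
    obtain ⟨i0, hi0, hi0'⟩ := hA
    obtain ⟨i, hip, hiD, hmax⟩ : ∃ i < p, ¬(x i = y i ∧ σ i = -τ i) ∧
        ∀ l, i < l → l ≤ p → (x l = y l ∧ σ l = -τ l) := by
      have hs := Nat.findGreatest_spec (P := fun i => ¬(x i = y i ∧ σ i = -τ i)) hi0.le hi0'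
      have hle := Nat.findGreatest_le (P := fun i => ¬(x i = y i ∧ σ i = -τ i)) p
      refine ⟨_, lt_of_le_of_ne hle ?_, hs, fun l h1 h2 => ?_⟩
      · intro h
        rw [h] at hs
        exact hs ⟨xe.trans ye.symm, opp⟩
      · by_contra h
        exact Nat.findGreatest_is_greatest h1 h2 h
    have start : ∃ j s, Reach a P (i + 1) j s ∧ j < x (i + 1) := by
      obtain ⟨h1, h2⟩ := hmax (i + 1) (by omega) (by omega)
      have hxr := hx.rule i (by omega)
      have hyr := hy.rule i (by omega)
      have hxlt := hx.lt i (by omega)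
      have hylt := hy.lt i (by omega)
      rcases (hx.prefix_reach (by omega) fun l hl => hxb l (by omega)).cross
        (hy.prefix_reach (by omega) fun l hl => hyb l (by omega))
        (hx.allowed i (by omega) (hxb i hip)) (hy.allowed i (by omega) (hyb i hip))
        (by rw [h1, h2, neg_mul, hyr, neg_neg] at hxr; rw [hxr, neg_neg]) hiD with ⟨-, h⟩ | ⟨-, h⟩
      · exact ⟨_, _, h, h1 ▸ hylt⟩
      · exact ⟨_, _, h, hxlt⟩
    have : ∀ m, i + 1 ≤ m → m ≤ p → ∃ j s, Reach a P m j s ∧ j < x m := by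
      intro m hm
      induction m, hm using Nat.le_induction with
      | base => exact fun _ => start
      | succ m hm ih =>
        intro hmp
        obtain ⟨j, s, hR, hj⟩ := ih (by omega)
        refine ⟨x m, -(s * a m j) * a m (x m), hR.step hj
          (both m (by omega) (by omega) (hmax m (by omega) (by omega)) _) ?_, hx.lt m (by omega)⟩
        rw [mul_assoc, Int.units_mul_self, mul_one]
    exact xe ▸ this p hip le_rfl
  · -- the paths are opposite up to `e`, and differ afterwards
    push Not at hA
    classical
    have hspec := Nat.find_spec hne
    have hmin : ∀ l, l < Nat.find hne → (x l = y l ∧ σ l = -τ l) := by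
      intro l hl
      by_contra h
      exact Nat.find_min hne hl ⟨by omega, h⟩
    generalize Nat.find hne = i at hspec hmin
    obtain ⟨hir, hiD⟩ := hspec
    have hpi : p < i := by
      by_contra h
      rcases (not_lt.1 h).lt_or_eq with h | rfl
      · exact hiD (hA i h)
      · exact hiD ⟨xe.trans ye.symm, opp⟩
    -- extend a path with free last sign by one point
    have ext : ∀ (m : ℕ) (u b : α) (t : ℤˣ), (∀ s, Reach a P m u s) → u < b → P b t →
        Reach a P (m + 1) b t := by
      intro m u b t hR hub hP
      refine (hR (-(t * a m b) * a m u)).step hub hP ?_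
      rw [mul_assoc, Int.units_mul_self, mul_one, neg_neg]
    have pre : ∀ m < p, ∀ s, Reach a P m (x m) s := by
      intro m
      induction m with
      | zero => exact fun h s => .base (both 0 (by omega) (by omega) (hmin 0 (by omega)) s)
      | succ m ih =>
        exact fun h s => ext m (x m) _ s (ih (by omega)) (hx.lt m (by omega))
          (both _ (by omega) (by omega) (hmin _ (by omega)) s)
    have jump : ∀ b t, x p < b → P b t → Reach a P p b t := by
      intro b t hb hP
      rcases p with _ | p
      · exact .base hP
      · exact ext p (x p) b t (pre p (by omega)) ((hx.lt p (by omega)).trans hb) hP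
    have post : ∀ m, p ≤ m → m + 1 < i → ∀ s, Reach a P m (x (m + 1)) s := by
      intro m hm
      induction m, hm using Nat.le_induction with
      | base =>
        exact fun h s => jump _ s (hx.lt p (by omega))
          (both _ (by omega) (by omega) (hmin _ (by omega)) s)
      | succ m hm ih =>
        exact fun h s => ext m _ _ s (ih (by omega)) (hx.lt (m + 1) (by omega))
          (both _ (by omega) (by omega) (hmin _ (by omega)) s)
    obtain ⟨t, rfl⟩ : ∃ t, i = t + 1 := ⟨i - 1, by omega⟩
    have last : ∀ b s, x t < b → P b s → Reach a P t b s := by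
      intro b s hb hP
      rcases Nat.lt_succ_iff_lt_or_eq.1 hpi with h | rfl
      · obtain ⟨t, rfl⟩ : ∃ t', t = t' + 1 := ⟨t - 1, by omega⟩
        exact ext t _ b s (post t (by omega) (by omega)) hb hP
      · exact jump b s hb hP
    obtain ⟨h1, h2⟩ := hmin t (by omega)
    have hxr := hx.rule t (by omega)
    have hyr := hy.rule t (by omega)
    have px := hx.allowed (t + 1) hir (hxa _ hpi hir)
    have py := hy.allowed (t + 1) hir (hya _ hpi hir)
    rcases (last _ _ (hx.lt t (by omega)) px).cross
      (last _ _ (h1 ▸ hy.lt t (by omega)) py) px py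
      (by rw [hxr, hyr, h1, h2, neg_mul]) hiD with ⟨-, h⟩ | ⟨-, h⟩
    · obtain ⟨j, s, h, -⟩ := hy.follow hir le_rfl (fun l h1 h2 => hya l (by omega) h2)
        ⟨_, _, h, Or.inr ⟨rfl, rfl⟩⟩
      exact ⟨j, s, h⟩
    · obtain ⟨j, s, h, -⟩ := hx.follow hir le_rfl (fun l h1 h2 => hxa l (by omega) h2)
        ⟨_, _, h, Or.inr ⟨rfl, rfl⟩⟩
      exact ⟨j, s, h⟩

end Elim

theorem lawrence_elimination {r n : ℕ} (A : Matrix (Fin r) (Fin n) ℤˣ) (X : Fin n → SignType)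
    (hX : X ∈ lawrenceCircuits A) (Y : Fin n → SignType) (hY : Y ∈ lawrenceCircuits A)
    (hne : X ≠ -Y) (e : Fin n) (hXe : X e = 1) (hYe : Y e = -1) :
    ∃ Z ∈ lawrenceCircuits A, Z e = 0 ∧ (∀ f, Z f = 1 → X f = 1 ∨ Y f = 1) ∧
      (∀ f, Z f = -1 → X f = -1 ∨ Y f = -1) := by
  rw [mem_lawrenceCircuits] at hX hY
  obtain ⟨J, s, hJ1, hJ2, hJ3⟩ := hX
  obtain ⟨K, t, hK1, hK2, hK3⟩ := hY
  let a : ℕ → Fin n → ℤˣ := fun i j => if h : i < r then A ⟨i, h⟩ j else 1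
  let P : Fin n → ℤˣ → Prop := fun j s => j ≠ e ∧ (X j = unitSign s ∨ Y j = unitSign s)
  let seq : ∀ {β : Type}, (Fin (r + 1) → β) → ℕ → β := fun g i =>
    if h : i < r + 1 then g ⟨i, h⟩ else g 0
  have path : ∀ (J : Fin (r + 1) ↪o Fin n) (s : Fin (r + 1) → ℤˣ),
      (∀ i, X (J i) = unitSign (s i) ∨ Y (J i) = unitSign (s i)) →
      (∀ i : Fin r, s i.succ * A i (J i.succ) = -(s i.castSucc * A i (J i.castSucc))) →
      IsPath a P r e (seq J) (seq s) := by
    intro J s h1 h3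
    refine ⟨fun i hi => ?_, fun i hi => ?_, fun i hi hie => ?_⟩
    · simp only [seq, show i < r + 1 by omega, show i + 1 < r + 1 by omega, dif_pos]
      exact J.strictMono (by rw [Fin.lt_def]; simp)
    · simp only [seq, a, show i < r + 1 by omega, show i + 1 < r + 1 by omega, hi, dif_pos]
      exact h3 ⟨i, hi⟩
    · have hi' : i < r + 1 := by omega
      simp only [seq, hi', dif_pos] at hie ⊢
      exact ⟨hie, h1 _⟩
  have pX := path J s (fun i => Or.inl (hJ1 i)) hJ3
  have pY := path K t (fun i => Or.inr (hK1 i)) hK3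
  have hp : e ∈ Set.range J := by
    by_contra h
    rw [hJ2 e h] at hXe
    exact absurd hXe (by decide)
  have hq : e ∈ Set.range K := by
    by_contra h
    rw [hK2 e h] at hYe
    exact absurd hYe (by decide)
  obtain ⟨p, hp⟩ := hp
  obtain ⟨q, hq⟩ := hq
  have sp : s p = 1 := by
    rw [← hp, hJ1] at hXe
    rcases unitSign_cases (s p) with h | h
    · exact h.1
    · rw [h.2] at hXe
      exact absurd hXe (by decide)
  have tq : t q = -1 := by
    rw [← hq, hK1] at hYe
    rcases unitSign_cases (t q) with h | h
    · rw [h.2] at hYe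
      exact absurd hYe (by decide)
    · exact h.1
  have val : ∀ {β : Type} (g : Fin (r + 1) → β) (i : Fin (r + 1)), seq g i = g i := by
    intro β g i
    exact dif_pos i.2
  obtain ⟨j, w, hR⟩ : ∃ j w, Reach a P r j w := by
    rcases lt_trichotomy p q with h | h | h
    · exact elim_lt (p := p) (q := q) pX pY (by omega) h (by rw [val, hp]) (by rw [val, hq])
        (by rw [val, val, sp, tq, neg_neg])
    · subst h
      refine elim_eq (p := p) pX pY (by omega) (by rw [val, hp]) (by rw [val, hq])
        (by rw [val, val, sp, tq, neg_neg]) ?_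
      by_contra! hcon
      have hcon' : ∀ i, J i = K i ∧ s i = -t i := by
        intro i
        have := hcon i (by omega)
        rwa [val, val, val, val] at this
      have hJK : Set.range J = Set.range K := by
        congr 1
        funext i
        exact (hcon' i).1
      apply hne
      funext f
      by_cases hf : f ∈ Set.range J
      · obtain ⟨i, rfl⟩ := hf
        rw [Pi.neg_apply, hJ1, (hcon' i).1, hK1, (hcon' i).2]
        rcases Int.units_eq_one_or (t i) with h | h <;> rw [h] <;> decide
      · rw [Pi.neg_apply, hJ2 f hf, hK2 f (hJK ▸ hf), neg_zero]
    · exact elim_lt (p := q) (q := p) pY pX (by omega) h (by rw [val, hq]) (by rw [val, hp])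
        (by rw [val, val, sp, tq])
  obtain ⟨z, w, -, -, hz1, hz2, hz3⟩ := hR.exists_path
  have hmono : StrictMono fun i : Fin (r + 1) => z i := by
    rw [Fin.strictMono_iff_lt_succ]
    intro i
    simpa using hz1 i i.2
  let L : Fin (r + 1) ↪o Fin n := OrderEmbedding.ofStrictMono _ hmono
  classical
  let Z : Fin n → SignType := fun f => if h : f ∈ Set.range L then unitSign (w h.choose) else 0
  have hZ1 : ∀ i, Z (L i) = unitSign (w i) := by
    intro i
    have h : L i ∈ Set.range L := ⟨i, rfl⟩
    have h2 : h.choose = i := L.injective h.choose_spec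
    simp only [Z, h, dif_pos, h2]
  have hZ2 : ∀ f, f ∉ Set.range L → Z f = 0 := by
    intro f hf
    simp only [Z, hf, dif_neg, not_false_eq_true]
  have hZP : ∀ f, Z f ≠ 0 → f ≠ e ∧ (X f = Z f ∨ Y f = Z f) := by
    intro f hf
    have : f ∈ Set.range L := by
      by_contra h
      exact hf (hZ2 f h)
    obtain ⟨i, rfl⟩ := this
    rw [hZ1]
    exact hz3 i (by omega)
  refine ⟨Z, (mem_lawrenceCircuits A Z).2 ⟨L, fun i => w i, hZ1, hZ2, fun i => ?_⟩, ?_,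
    fun f hf => ?_, fun f hf => ?_⟩
  · have := hz2 i i.2
    simpa [a, L] using this
  · by_contra h
    exact (hZP e h).1 rfl
  · have := (hZP f (by rw [hf]; decide)).2
    rwa [hf] at this
  · have := (hZP f (by rw [hf]; decide)).2
    rwa [hf] at this

/-- The Lawrence oriented matroid `M_A` of a matrix `A` with entries `1` and `-1`; it is uniform of
rank `r` on `n` elements when `r ≤ n`. -/
def lawrence {r n : ℕ} (A : Matrix (Fin r) (Fin n) ℤˣ) : OrientedMatroid (Fin n) where
  circuits := lawrenceCircuits A
  zero_notMem := by
    rintro ⟨J, h, -⟩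
    exact (h (J 0)).2 ⟨0, rfl⟩ rfl
  neg_mem := by
    rintro X ⟨J, h, h'⟩
    refine ⟨J, fun e => by rw [← h e]; simp, fun i => ?_⟩
    rw [h' i]
    simp
  eq_or_eq_neg := by
    intro X hX Y hY h
    rw [mem_lawrenceCircuits] at hX hY
    obtain ⟨J, s, hJ1, hJ2, hJ3⟩ := hX
    obtain ⟨K, t, hK1, hK2, hK3⟩ := hY
    have hu : ∀ u : ℤˣ, unitSign u ≠ 0 := by decide
    have hsub : Finset.univ.map J.toEmbedding ⊆ Finset.univ.map K.toEmbedding := by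
      intro f hf
      obtain ⟨i, -, rfl⟩ := Finset.mem_map.1 hf
      have h1 : Y (J i) ≠ 0 := h _ (by rw [hJ1]; exact hu _)
      by_contra hK
      refine h1 (hK2 _ ?_)
      rintro ⟨l, hl⟩
      exact hK (Finset.mem_map.2 ⟨l, Finset.mem_univ _, hl⟩)
    have heq := Finset.eq_of_subset_of_card_le hsub (by simp)
    have hJK : J = K := by
      have hr : Set.range J = Set.range K := by
        have := congrArg (fun S : Finset (Fin n) => (S : Set (Fin n))) heq
        simpa using this
      exact DFunLike.coe_injective ((StrictMono.range_inj J.strictMono K.strictMono).1 hr)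
    subst hJK
    have hst : ∀ i, s i * t i = s 0 * t 0 := by
      intro i
      induction i using Fin.induction with
      | zero => rfl
      | succ i ih =>
        rw [← ih]
        have h1 := hJ3 i
        have h2 := hK3 i
        have h3 := congrArg₂ (· * ·) h1 h2
        simp only [neg_mul_neg] at h3
        rw [mul_mul_mul_comm, mul_mul_mul_comm (s i.castSucc), Int.units_mul_self,
          Int.units_mul_self, mul_one, mul_one] at h3
        exact h3
    rcases Int.units_eq_one_or (s 0 * t 0) with h0 | h0
    · left
      funext f
      by_cases hf : f ∈ Set.range J
      · obtain ⟨i, rfl⟩ := hf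
        rw [hJ1, hK1]
        have := hst i
        rw [h0] at this
        rw [mul_eq_one_iff_eq_inv.1 this, Int.units_inv_eq_self]
      · rw [hJ2 f hf, hK2 f hf]
    · right
      funext f
      by_cases hf : f ∈ Set.range J
      · obtain ⟨i, rfl⟩ := hf
        rw [Pi.neg_apply, hJ1, hK1]
        have := hst i
        rw [h0] at this
        revert this
        generalize s i = u
        generalize t i = v
        revert u v
        decide
      · rw [Pi.neg_apply, hJ2 f hf, hK2 f hf, neg_zero]
  elimination := lawrence_elimination A

/-- `M` is a Lawrence oriented matroid of rank `r` on the ordered set `Fin n`. -/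
def IsLawrence {n : ℕ} (r : ℕ) (M : OrientedMatroid (Fin n)) : Prop :=
  ∃ A : Matrix (Fin r) (Fin n) ℤˣ, M = lawrence A

/-- The signed sets with support `j_0 < ⋯ < j_r` whose signs alternate. -/
def alternatingCircuits (r n : ℕ) : Set (Fin n → SignType) :=
  {X | ∃ J : Fin (r + 1) ↪o Fin n, (∀ e, X e ≠ 0 ↔ e ∈ Set.range J) ∧
    ∀ i : Fin r, X (J i.castSucc) = -X (J i.succ)}

theorem alternatingCircuits_eq (r n : ℕ) :
    alternatingCircuits r n = lawrenceCircuits (fun (_ : Fin r) (_ : Fin n) => (1 : ℤˣ)) := by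
  ext X
  refine exists_congr fun J => and_congr_right fun h => forall_congr' fun i => ?_
  have h1 : X (J i.castSucc) ≠ 0 := (h _).2 ⟨_, rfl⟩
  have h2 : X (J i.succ) ≠ 0 := (h _).2 ⟨_, rfl⟩
  simp only [basisSign, Finset.prod_const_one]
  revert h1 h2
  generalize X (J i.castSucc) = u
  generalize X (J i.succ) = v
  revert u v
  decide

/-- The alternating oriented matroid `C_r(n)`. -/
def alternating (r n : ℕ) : OrientedMatroid (Fin n) where
  circuits := alternatingCircuits r n
  zero_notMem := by rw [alternatingCircuits_eq]; exact (lawrence _).zero_notMem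
  neg_mem := by rw [alternatingCircuits_eq]; exact (lawrence _).neg_mem
  eq_or_eq_neg := by rw [alternatingCircuits_eq]; exact (lawrence _).eq_or_eq_neg
  elimination := by rw [alternatingCircuits_eq]; exact (lawrence _).elimination

/-- `c_r(n, k)`, the number of `k`-neighborly reorientations of `C_r(n)`. -/
noncomputable def alternatingCount (r n k : ℕ) : ℕ :=
  (alternating r n).numNeighborly k

/-- The reorientation classes `[M]` of the rank `r` Lawrence oriented matroids `M ∉ [C_r(n)]` on `n`
elements that have exactly `c_r(n, k)` `k`-neighborly reorientations. -/
def equalityClasses (r n k : ℕ) : Set (Set (OrientedMatroid (Fin n))) :=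
  {K | ∃ M : OrientedMatroid (Fin n), IsLawrence r M ∧
    M ∉ (alternating r n).reorientationClass ∧
    M.numNeighborly k = alternatingCount r n k ∧ K = M.reorientationClass}

end Lawrence

end OrientedMatroid

/-!
For a Lawrence oriented matroid the number of `k`-neighborly reorientations does not change under
reorientation, and every Lawrence oriented matroid is a reorientation of that of a matrix in a normal
form with `7 * D` free signs, where `D = n - 9` (`exists_board`). Different matrices in normal form
give different reorientation classes (`board_injective`): the product of two entries of the same row
can be read off from a circuit in which their columns are consecutive. The matrix without entries
`-1` is in normal form and gives the alternating oriented matroid. The theorem is therefore a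
statement about the `2 ^ 14` or `2 ^ 21` values of an explicit function: the value at the constant
matrix is the maximum, and it is taken `256` or `512` times, once by the constant matrix itself.

The function is evaluated with a finite automaton. A circuit arises by scanning the columns from left
to right, keeping all columns but `D` of them (`mem_lawrenceCircuits_iff_scan`). The only data to
remember are the number of columns deleted so far (the level) and a sign (the carry) that turns the
next matrix entry into the sign of the next element. So a reorientation fails to be `k`-neighborly
exactly if some path through the columns collects at most `k` negative signs
(`not_isNeighborly_reorient_iff`). The triples (carry, level, number of negative signs still
allowed) are the states of a nondeterministic automaton with `32` states; the subset construction
turns a set of such triples into a 32-bit number on which a column acts by bit operations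
(`fails_step`).

Only a few hundred of these numbers occur at each column. For each of them, the counts for all
fillings of the remaining columns are packed as digits into one large number, and the numbers of two
consecutive columns are related by additions and shifts (`packedCount_eq`). The maximum and its
multiplicity are then read off from a single packed number by bitwise operations (`maxTest_sound`).
The numbers `packedCount` are evaluated by the kernel, whose arithmetic on numerals is fast; `force`
makes sure that each occurring state is treated only once.
-/

namespace OrientedMatroid

/-! ### Families of numbers packed into one number -/

/-- The family `F l`, `l` ranging over the Boolean lists of length `m` in lexicographic order,
written as the list of digits of a single number in base `2 ^ 14`. The values to be packed are at most
`2 ^ 12`, which leaves room in each digit for the comparison in `maxTest`. -/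
def pack : ℕ → (List Bool → ℕ) → ℕ
  | 0, F => F []
  | m + 1, F => pack m (fun l => F (false :: l)) +
      2 ^ (14 * 2 ^ m) * pack m (fun l => F (true :: l))

theorem pack_congr {m : ℕ} {F G : List Bool → ℕ} (h : ∀ l, l.length = m → F l = G l) :
    pack m F = pack m G := by
  induction m generalizing F G with
  | zero => exact h [] rfl
  | succ m ih =>
    simp only [pack]
    rw [ih fun l hl => h (false :: l) (by simp [hl]), ih fun l hl => h (true :: l) (by simp [hl])]

theorem pack_add (m : ℕ) (F G : List Bool → ℕ) :
    pack m F + pack m G = pack m (fun l => F l + G l) := by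
  induction m generalizing F G with
  | zero => rfl
  | succ m ih => simp only [pack, ← ih]; ring

theorem pack_lt {m : ℕ} {F : List Bool → ℕ} (h : ∀ l, l.length = m → F l < 2 ^ 14) :
    pack m F < 2 ^ (14 * 2 ^ m) := by
  induction m generalizing F with
  | zero => simpa [pack] using h [] rfl
  | succ m ih =>
    have h0 := ih (F := fun l => F (false :: l)) fun l hl => h _ (by simp [hl])
    have h1 := ih (F := fun l => F (true :: l)) fun l hl => h _ (by simp [hl])
    simp only [pack]
    rw [pow_succ 2 m, ← mul_assoc, pow_mul _ _ 2]
    nlinarith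

theorem add_mul_two_pow_land {k a b c d : ℕ} (ha : a < 2 ^ k) (hc : c < 2 ^ k) :
    (a + 2 ^ k * b) &&& (c + 2 ^ k * d) = (a &&& c) + 2 ^ k * (b &&& d) := by
  have hac : a &&& c < 2 ^ k := Nat.and_lt_two_pow _ hc
  refine Nat.eq_of_testBit_eq fun i => ?_
  rw [add_comm a, add_comm c, add_comm (a &&& c), Nat.testBit_and]
  rw [Nat.testBit_two_pow_mul_add _ ha, Nat.testBit_two_pow_mul_add _ hc,
    Nat.testBit_two_pow_mul_add _ hac]
  split_ifs <;> simp

theorem pack_land {m : ℕ} {F G : List Bool → ℕ} (hF : ∀ l, l.length = m → F l < 2 ^ 14)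
    (hG : ∀ l, l.length = m → G l < 2 ^ 14) :
    pack m F &&& pack m G = pack m (fun l => F l &&& G l) := by
  induction m generalizing F G with
  | zero => rfl
  | succ m ih =>
    simp only [pack]
    rw [add_mul_two_pow_land (pack_lt fun l hl => hF _ (by simp [hl]))
      (pack_lt fun l hl => hG _ (by simp [hl]))]
    rw [ih (fun l hl => hF _ (by simp [hl])) (fun l hl => hG _ (by simp [hl])),
      ih (fun l hl => hF _ (by simp [hl])) (fun l hl => hG _ (by simp [hl]))]

theorem pack_eq_zero {m : ℕ} {F : List Bool → ℕ} :
    pack m F = 0 ↔ ∀ l, l.length = m → F l = 0 := by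
  induction m generalizing F with
  | zero => simp [pack]
  | succ m ih =>
    simp only [pack, Nat.add_eq_zero_iff, mul_eq_zero, pow_eq_zero_iff', OfNat.ofNat_ne_zero,
      false_and, false_or, ih]
    refine ⟨fun h l hl => ?_, fun h => ⟨fun l hl => h _ (by simp [hl]), fun l hl => h _ (by simp [hl])⟩⟩
    match l, hl with
    | false :: l, hl => exact h.1 l (by simpa using hl)
    | true :: l, hl => exact h.2 l (by simpa using hl)

theorem pack_mod {m : ℕ} {F : List Bool → ℕ} (hF : F (List.replicate m false) < 2 ^ 14) :
    pack m F % 2 ^ 14 = F (List.replicate m false) := by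
  induction m generalizing F with
  | zero => exact Nat.mod_eq_of_lt hF
  | succ m ih =>
    simp only [pack, List.replicate_succ]
    have : 2 ^ (14 * 2 ^ m) = 2 ^ 14 * 2 ^ (14 * 2 ^ m - 14) := by
      rw [← pow_add]
      congr 1
      have := Nat.one_le_two_pow (n := m)
      omega
    rw [this, mul_assoc, Nat.add_mul_mod_self_left]
    exact ih hF

/-- The number whose `2 ^ m` digits in base `2 ^ 14` are all equal to `v`. -/
def packConst : ℕ → ℕ → ℕ
  | 0, v => v
  | m + 1, v => Nat.add (packConst m v) (Nat.shiftLeft (packConst m v) (14 * 2 ^ m))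

theorem packConst_eq (m v : ℕ) : packConst m v = pack m fun _ => v := by
  induction m with
  | zero => rfl
  | succ m ih =>
    change packConst m v + packConst m v <<< (14 * 2 ^ m) = _
    simp only [pack, Nat.shiftLeft_eq, ih, mul_comm]

/-- The number of nonzero digits among the `2 ^ m` digits of `X` in base `2 ^ 14`. The test for zero
cuts off the search in the empty parts of `X`. -/
def numNonzero : ℕ → ℕ → ℕ
  | 0, X => cond (Nat.beq X 0) 0 1
  | m + 1, X => cond (Nat.beq X 0) 0
      (Nat.add (numNonzero m (X % 2 ^ (14 * 2 ^ m))) (numNonzero m (X / 2 ^ (14 * 2 ^ m))))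

theorem ncard_cons {m : ℕ} (p : List Bool → Prop) :
    {l : List Bool | l.length = m + 1 ∧ p l}.ncard =
      {l : List Bool | l.length = m ∧ p (false :: l)}.ncard +
        {l : List Bool | l.length = m ∧ p (true :: l)}.ncard := by
  have hfin : ∀ (k : ℕ) (q : List Bool → Prop), {l : List Bool | l.length = k ∧ q l}.Finite :=
    fun k q => (List.finite_length_eq Bool k).subset fun l hl => hl.1
  rw [← Set.ncard_image_of_injective {l : List Bool | l.length = m ∧ p (false :: l)}
      (List.cons_injective (a := false)),
    ← Set.ncard_image_of_injective {l : List Bool | l.length = m ∧ p (true :: l)}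
      (List.cons_injective (a := true)), ← Set.ncard_union_eq _ ((hfin _ _).image _)
      ((hfin _ _).image _)]
  · congr 1
    ext l
    match l with
    | [] => simp
    | false :: l => simp
    | true :: l => simp
  · rw [Set.disjoint_left]
    rintro _ ⟨l, -, rfl⟩ ⟨l', -, h⟩
    simp at h

theorem numNonzero_pack {m : ℕ} {F : List Bool → ℕ} (h : ∀ l, l.length = m → F l < 2 ^ 14) :
    numNonzero m (pack m F) = {l : List Bool | l.length = m ∧ F l ≠ 0}.ncard := by
  induction m generalizing F with
  | zero =>
    simp only [numNonzero, pack, List.length_eq_zero_iff]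
    by_cases h0 : F [] = 0
    · have : {l : List Bool | l = [] ∧ F l ≠ 0} = ∅ := by
        ext l; simp only [Set.mem_ofPred_eq, Set.mem_empty_iff_false, iff_false]
        rintro ⟨rfl, h⟩; exact h h0
      simp [h0, this]
    · have : {l : List Bool | l = [] ∧ F l ≠ 0} = {[]} := by
        ext l; simp only [Set.mem_ofPred_eq, Set.mem_singleton_iff]
        exact ⟨fun h => h.1, fun h => ⟨h, h ▸ h0⟩⟩
      rw [this, Set.ncard_singleton]
      have : Nat.beq (F []) 0 = false := by
        rw [Bool.eq_false_iff]; intro hb; exact h0 (Nat.eq_of_beq_eq_true hb)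
      simp [this]
  | succ m ih =>
    rw [ncard_cons]
    have hlo := pack_lt (m := m) (F := fun l => F (false :: l)) fun l hl => h _ (by simp [hl])
    have e1 : pack (m + 1) F % 2 ^ (14 * 2 ^ m) = pack m fun l => F (false :: l) := by
      simp only [pack, Nat.add_mul_mod_self_left]
      exact Nat.mod_eq_of_lt hlo
    have e2 : pack (m + 1) F / 2 ^ (14 * 2 ^ m) = pack m fun l => F (true :: l) := by
      simp only [pack]
      rw [Nat.add_mul_div_left _ _ (by positivity), Nat.div_eq_of_lt hlo, zero_add]
    simp only [numNonzero, e1, e2]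
    rw [ih (fun l hl => h _ (by simp [hl])), ih (fun l hl => h _ (by simp [hl]))]
    by_cases h0 : pack (m + 1) F = 0
    · have hz := pack_eq_zero.1 h0
      have : ∀ b, {l : List Bool | l.length = m ∧ F (b :: l) ≠ 0} = ∅ := by
        intro b
        ext l
        simp only [Set.mem_ofPred_eq, Set.mem_empty_iff_false, iff_false, not_and, not_not]
        exact fun hl => hz _ (by simp [hl])
      simp [h0, this]
    · have : Nat.beq (pack (m + 1) F) 0 = false := by
        rw [Bool.eq_false_iff]; intro hb; exact h0 (Nat.eq_of_beq_eq_true hb)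
      simp only [this, cond_false]
      rfl

/-- A bitwise test on the packed values of `F`: the value at the list `false, …, false` is `c`, no
value exceeds `c`, and exactly `N` values are equal to `c`. The bit `13` of a digit `a + q` tells
whether `a + q ≥ 2 ^ 13`; for `q = 2 ^ 13 - 1 - c` this means `a > c`, and for `q = 2 ^ 13 - c` it
means `a ≥ c`. -/
def maxTest (m c N X : ℕ) : Bool :=
  Nat.beq (X % 2 ^ 14) c &&
  (Nat.beq (Nat.land (Nat.add X (packConst m (2 ^ 13 - 1 - c))) (packConst m (2 ^ 13))) 0 &&
  Nat.beq (numNonzero m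
    (Nat.land (Nat.add X (packConst m (2 ^ 13 - c))) (packConst m (2 ^ 13)))) N)

theorem land_two_pow_eq_zero {a : ℕ} (ha : a < 2 ^ 14) : a &&& 2 ^ 13 = 0 ↔ a < 2 ^ 13 := by
  rw [Nat.and_two_pow]
  have h : a.testBit 13 = decide (2 ^ 13 ≤ a) := by
    rw [Nat.testBit_eq_decide_div_mod_eq]
    congr 1
    rw [eq_iff_iff]
    omega
  rw [h]
  simp

theorem maxTest_sound {m c N : ℕ} {F : List Bool → ℕ} (hF : ∀ l, l.length = m → F l ≤ 2 ^ 12)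
    (hc : c ≤ 2 ^ 12) (h : maxTest m c N (pack m F) = true) :
    F (List.replicate m false) = c ∧ (∀ l, l.length = m → F l ≤ c) ∧
      {l : List Bool | l.length = m ∧ F l = c}.ncard = N := by
  simp only [maxTest, Bool.and_eq_true] at h
  obtain ⟨h1, h2, h3⟩ := h
  replace h1 := Nat.eq_of_beq_eq_true h1
  replace h2 := Nat.eq_of_beq_eq_true h2
  replace h3 := Nat.eq_of_beq_eq_true h3
  have hsum : ∀ q, q ≤ 2 ^ 13 → (pack m F + packConst m q) &&& packConst m (2 ^ 13) =
      pack m fun l => (F l + q) &&& 2 ^ 13 := by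
    intro q hq
    rw [packConst_eq, packConst_eq, pack_add, pack_land]
    · intro l hl
      have := hF l hl
      omega
    · intro l _
      norm_num
  have hlt : ∀ l, l.length = m → ∀ q, q ≤ 2 ^ 13 →
      ((F l + q) &&& 2 ^ 13 = 0 ↔ F l + q < 2 ^ 13) := fun l hl q hq =>
    land_two_pow_eq_zero (by have := hF l hl; omega)
  have hle : ∀ l, l.length = m → F l ≤ c := by
    intro l hl
    change (pack m F + packConst m (2 ^ 13 - 1 - c)) &&& packConst m (2 ^ 13) = 0 at h2
    rw [hsum _ (by omega), pack_eq_zero] at h2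
    have := (hlt l hl _ (by omega)).1 (h2 l hl)
    omega
  refine ⟨?_, hle, ?_⟩
  · rw [← h1, pack_mod]
    exact lt_of_le_of_lt (hF _ (by simp)) (by norm_num)
  · change numNonzero m ((pack m F + packConst m (2 ^ 13 - c)) &&& packConst m (2 ^ 13)) = N at h3
    rw [hsum _ (by omega), numNonzero_pack] at h3
    · rw [← h3]
      congr 1
      ext l
      simp only [Set.mem_ofPred_eq]
      refine and_congr_right fun hl => ?_
      rw [Ne, hlt l hl _ (by omega)]
      have := hle l hl
      omega
    · intro l _
      exact lt_of_le_of_lt Nat.and_le_right (by norm_num)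

/-! ### The automaton -/

/-- Some path starting at level `d` with carry `g` picks up at most `t` negative signs along the
columns `w` and ends at level `D`. A column is a letter `v`, whose bit `4 * d` is the entry met at
level `d` (`true` standing for `-1`), together with a bit telling whether the column is reoriented.
The path either keeps the column, which contributes a sign and updates the carry, or deletes it,
which raises the level. The bit `4 * d` of `16 * v` is the entry at level `d - 1`, hence on the
following row, and `false` for `d = 0`. -/
def HasLightPath (D : ℕ) : List (ℕ × Bool) → ℕ → Bool → ℕ → Prop
  | [], d, _, _ => d = D
  | (v, x) :: w, d, g, t =>
    (if (g ^^ v.testBit (4 * d) ^^ x) = true then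
      0 < t ∧ HasLightPath D w d (!(g ^^ v.testBit (4 * d) ^^ (16 * v).testBit (4 * d))) (t - 1)
    else HasLightPath D w d (!(g ^^ v.testBit (4 * d) ^^ (16 * v).testBit (4 * d))) t) ∨
    HasLightPath D w (d + 1) g t

theorem HasLightPath.level_le {D : ℕ} {w : List (ℕ × Bool)} {d : ℕ} {g : Bool} {t : ℕ}
    (h : HasLightPath D w d g t) : d ≤ D := by
  induction w generalizing d g t with
  | nil => exact le_of_eq h
  | cons c w ih =>
    rcases h with h | h
    · split_ifs at h
      · exact ih h.2
      · exact ih h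
    · exact (Nat.le_succ d).trans (ih h)

theorem HasLightPath.mono {D : ℕ} {w : List (ℕ × Bool)} {d : ℕ} {g : Bool} {t t' : ℕ}
    (h : HasLightPath D w d g t) (ht : t ≤ t') : HasLightPath D w d g t' := by
  induction w generalizing d g t t' with
  | nil => exact h
  | cons c w ih =>
    refine h.imp (fun h => ?_) fun h => ih h ht
    split_ifs at h ⊢
    · exact ⟨by omega, ih h.2 (by omega)⟩
    · exact ih h ht

/-- The bit of a state that stands for the carry `g`, the level `d < 4` and the budget `t < 4`. -/
def pos (g : Bool) (d t : ℕ) : ℕ := 16 * g.toNat + 4 * d + t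

/-- The set of triples (carry, level, budget) coded by `S` contains the start of a path that stays
within its budget. -/
def Fails (D : ℕ) (w : List (ℕ × Bool)) (S : ℕ) : Prop :=
  ∃ g d t, d < 4 ∧ t < 4 ∧ S.testBit (pos g d t) = true ∧ HasLightPath D w d g t

/-- The letter of a column whose entries at the levels `1`, `2`, `3` are `a`, `b`, `c`; the entry at
level `0` is `false`. -/
def spread (a b c : Bool) : ℕ := 16 * a.toNat + 256 * b.toNat + 4096 * c.toNat

/-- `v` is a letter: all its bits other than those at `4`, `8` and `12` vanish. -/
def IsLetter (v : ℕ) : Prop := ∃ a b c, v = spread a b c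

/-- The bits of the pairs (carry, level) at which keeping the column gives a negative sign. The factor
`15` copies the bit `4 * d` of the letter to all four budgets. Here and in the following masks, `Nat`
functions are used in place of notation to spare the kernel the unfolding of instances. -/
def minusMask (v : ℕ) (x : Bool) : ℕ :=
  Nat.lor (Nat.xor (Nat.mul 15 v) (cond x 0xffff 0))
    (Nat.shiftLeft (Nat.xor (Nat.xor (Nat.mul 15 v) (cond x 0xffff 0)) 0xffff) 16)

/-- The bits, for the carry `false`, of the levels at which keeping the column preserves the
carry. -/
def sameMask (v : ℕ) : ℕ :=
  Nat.land (Nat.mul 15 (Nat.xor v (Nat.shiftLeft v 4))) 0xffff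

/-- Lower the budget by one where keeping the column gives a negative sign. The mask `0xeeeeeeee`
removes the budget `0` before the shift. -/
def spend (v : ℕ) (x : Bool) (S : ℕ) : ℕ :=
  Nat.lor (Nat.land S (Nat.xor (minusMask v x) 0xffffffff))
    (Nat.shiftRight (Nat.land S (Nat.land (minusMask v x) 0xeeeeeeee)) 1)

/-- The set of triples (carry, level, budget) reached from those in `S` by reading one column. After
`spend`, the bits whose carry is preserved stay in place and the others move to the opposite carry,
`16` positions away. Deleting the column, possible at the levels below `D`, shifts by one level. -/
def step (D v : ℕ) (x : Bool) (S : ℕ) : ℕ :=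
  Nat.lor
    (Nat.lor (Nat.land (spend v x S) (Nat.lor (sameMask v) (Nat.shiftLeft (sameMask v) 16)))
      (Nat.shiftRight (Nat.land (spend v x S)
        (Nat.xor (Nat.lor (sameMask v) (Nat.shiftLeft (sameMask v) 16)) 0xffffffff)) 16))
    (Nat.lor (Nat.shiftLeft (Nat.land (spend v x S) (Nat.xor (sameMask v) 0xffff)) 16)
      (Nat.shiftLeft (Nat.land S (Nat.mul (Nat.sub (Nat.pow 16 D) 1) 0x10001)) 4))

theorem minusMask_testBit : ∀ a b c x g : Bool, ∀ d < 4, ∀ t < 4,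
    (minusMask (spread a b c) x ^^^ 0xffffffff).testBit (pos g d t) =
      !(g ^^ (spread a b c).testBit (4 * d) ^^ x) ∧
    (minusMask (spread a b c) x &&& 0xeeeeeeee).testBit (pos g d t + 1) =
      (decide (t < 3) && (g ^^ (spread a b c).testBit (4 * d) ^^ x)) := by
  decide +kernel

theorem sameMask_testBit : ∀ a b c : Bool, ∀ d < 4, ∀ t < 4,
    (∀ g, (sameMask (spread a b c) ||| sameMask (spread a b c) <<< 16).testBit (pos g d t) =
      ((spread a b c).testBit (4 * d) ^^ (16 * spread a b c).testBit (4 * d))) ∧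
    (∀ g, ((sameMask (spread a b c) ||| sameMask (spread a b c) <<< 16) ^^^ 0xffffffff).testBit
      (16 + pos g d t) =
      (!g && !((spread a b c).testBit (4 * d) ^^ (16 * spread a b c).testBit (4 * d)))) ∧
    (sameMask (spread a b c) ^^^ 0xffff).testBit (pos false d t) =
      !((spread a b c).testBit (4 * d) ^^ (16 * spread a b c).testBit (4 * d)) := by
  decide +kernel

theorem lowMask_testBit : ∀ D < 4, ∀ g, ∀ d < 4, ∀ t < 4,
    ((16 ^ D - 1) * 0x10001).testBit (pos g d t) = decide (d < D) := by
  decide +kernel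

theorem lowMask_testBit_true : ∀ D < 4, ∀ t < 4,
    (4 ≤ pos true 0 t) ∧ ((16 ^ D - 1) * 0x10001).testBit (pos true 0 t - 4) = false := by
  decide +kernel

theorem spend_testBit {v : ℕ} (hv : IsLetter v) (x : Bool) (S : ℕ) (g : Bool) {d t : ℕ}
    (hd : d < 4) (ht : t < 4) :
    (spend v x S).testBit (pos g d t) =
      if (g ^^ v.testBit (4 * d) ^^ x) = true then decide (t < 3) && S.testBit (pos g d (t + 1))
      else S.testBit (pos g d t) := by
  obtain ⟨a, b, c, rfl⟩ := hv
  obtain ⟨h1, h2⟩ := minusMask_testBit a b c x g d hd t ht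
  change ((S &&& (minusMask (spread a b c) x ^^^ 0xffffffff)) |||
    ((S &&& (minusMask (spread a b c) x &&& 0xeeeeeeee)) >>> 1)).testBit _ = _
  rw [Nat.testBit_or, Nat.testBit_shiftRight, Nat.testBit_and S, Nat.testBit_and S, add_comm 1,
    h1, h2, show pos g d t + 1 = pos g d (t + 1) from rfl]
  generalize (g ^^ (spread a b c).testBit (4 * d) ^^ x) = m
  cases m <;> simp [Bool.and_comm]

theorem step_testBit {D v : ℕ} (hD : D < 4) (hv : IsLetter v) (x : Bool) (S : ℕ) (g : Bool)
    {d t : ℕ} (hd : d < 4) (ht : t < 4) :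
    (step D v x S).testBit (pos g d t) = true ↔
      (spend v x S).testBit (pos (!(g ^^ v.testBit (4 * d) ^^ (16 * v).testBit (4 * d))) d t) =
        true ∨ (∃ d', d = d' + 1 ∧ d' < D ∧ S.testBit (pos g d' t) = true) := by
  obtain ⟨a, b, c, rfl⟩ := hv
  obtain ⟨h1, h2, h3⟩ := sameMask_testBit a b c d hd t ht
  set v := spread a b c
  have hlast : (((S &&& ((16 ^ D - 1) * 0x10001)) <<< 4).testBit (pos g d t) = true) ↔
      ∃ d', d = d' + 1 ∧ d' < D ∧ S.testBit (pos g d' t) = true := by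
    rw [Nat.testBit_shiftLeft, Nat.testBit_and]
    rcases d with _ | d
    · cases g
      · have : ¬ 4 ≤ pos false 0 t := by simp [pos]; omega
        simp [this]
      · simp [(lowMask_testBit_true D hD t ht).2]
    · have e : pos g (d + 1) t - 4 = pos g d t := by simp only [pos]; omega
      have e' : 4 ≤ pos g (d + 1) t := by simp only [pos]; omega
      rw [e, lowMask_testBit D hD g d (by omega) t ht]
      simp [e', and_comm]
  change ((((spend v x S &&& (sameMask v ||| sameMask v <<< 16)) |||
    ((spend v x S &&& ((sameMask v ||| sameMask v <<< 16) ^^^ 0xffffffff)) >>> 16)) |||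
    (((spend v x S &&& (sameMask v ^^^ 0xffff)) <<< 16) |||
      ((S &&& ((16 ^ D - 1) * 0x10001)) <<< 4)))).testBit _ = true ↔ _
  rw [Nat.testBit_or, Nat.testBit_or, Nat.testBit_or ((spend v x S &&& _) <<< 16), ← Bool.or_assoc,
    Bool.or_eq_true, hlast]
  refine or_congr_left ?_
  rw [Nat.testBit_shiftRight, Nat.testBit_shiftLeft, Nat.testBit_and, Nat.testBit_and,
    Nat.testBit_and, h1, h2]
  generalize (v.testBit (4 * d)) = p at *
  generalize ((16 * v).testBit (4 * d)) = q at *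
  cases g
  · have e1 : 16 + pos false d t = pos true d t := by simp [pos]; omega
    have e2 : ¬ 16 ≤ pos false d t := by simp [pos]; omega
    rw [e1]
    cases p <;> cases q <;> simp [e2]
  · have e1 : pos true d t - 16 = pos false d t := by simp [pos]; omega
    have e2 : 16 ≤ pos true d t := by simp [pos]; omega
    rw [e1, h3]
    cases p <;> cases q <;> simp [e2]

theorem carry_carry (g p q : Bool) : (!((!(g ^^ p ^^ q)) ^^ p ^^ q)) = g := by
  cases g <;> cases p <;> cases q <;> rfl

theorem fails_step {D v : ℕ} (hD : D < 4) (hv : IsLetter v) (x : Bool) (S : ℕ)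
    (w : List (ℕ × Bool)) : Fails D w (step D v x S) ↔ Fails D ((v, x) :: w) S := by
  constructor
  · rintro ⟨g, d, t, hd, ht, hS, hP⟩
    rcases (step_testBit hD hv x S g hd ht).1 hS with h | ⟨d', rfl, -, h⟩
    · rw [spend_testBit hv x S _ hd ht] at h
      split_ifs at h with hm
      · simp only [Bool.and_eq_true, decide_eq_true_eq] at h
        refine ⟨_, d, t + 1, hd, by omega, h.2, Or.inl ?_⟩
        rw [if_pos hm]
        refine ⟨by omega, ?_⟩
        rwa [carry_carry, Nat.add_sub_cancel]
      · refine ⟨_, d, t, hd, ht, h, Or.inl ?_⟩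
        rw [if_neg hm]
        rwa [carry_carry]
    · exact ⟨g, d', t, by omega, ht, h, Or.inr hP⟩
  · rintro ⟨g, d, t, hd, ht, hS, hP⟩
    have hg : (!((!(g ^^ v.testBit (4 * d) ^^ (16 * v).testBit (4 * d))) ^^ v.testBit (4 * d) ^^
        (16 * v).testBit (4 * d))) = g := carry_carry _ _ _
    rcases hP with hP | hP
    · split_ifs at hP with hm
      · refine ⟨_, d, t - 1, hd, by omega, (step_testBit hD hv x S _ hd (by omega)).2 (Or.inl ?_),
          hP.2⟩
        rw [hg, spend_testBit hv x S _ hd (by omega), if_pos hm,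
          show t - 1 + 1 = t from by omega]
        simp [hS]
        omega
      · refine ⟨_, d, t, hd, ht, (step_testBit hD hv x S _ hd ht).2 (Or.inl ?_), hP⟩
        rw [hg, spend_testBit hv x S _ hd ht, if_neg hm, hS]
    · have := hP.level_le
      exact ⟨g, d + 1, t, by omega, ht, (step_testBit hD hv x S _ (by omega) ht).2
        (Or.inr ⟨d, rfl, by omega, hS⟩), hP⟩

theorem finalMask_testBit : ∀ D < 4,
    (15 * 16 ^ D * 0x10001 < 2 ^ 32) ∧ ∀ i < 32, (15 * 16 ^ D * 0x10001).testBit i = true ↔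
      (∃ g, ∃ t < 4, i = pos g D t) := by
  decide +kernel

/-- `1` if no path coded by the state `S` ends at level `D`, and `0` otherwise. -/
def accepts (D S : ℕ) : ℕ :=
  cond (Nat.beq (Nat.land S (Nat.mul (Nat.mul 15 (Nat.pow 16 D)) 0x10001)) 0) 1 0

theorem accepts_eq {D : ℕ} (hD : D < 4) (S : ℕ) [Decidable (Fails D [] S)] :
    accepts D S = if Fails D [] S then 0 else 1 := by
  have key : Fails D [] S ↔ S &&& (15 * 16 ^ D * 0x10001) ≠ 0 := by
    obtain ⟨h1, h2⟩ := finalMask_testBit D hD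
    constructor
    · rintro ⟨g, d, t, -, ht, hS, rfl⟩ h0
      have hp : pos g d t < 32 := by
        have := g.toNat_le
        simp only [pos]; omega
      have := congrArg (fun n => n.testBit (pos g d t)) h0
      simp [hS, (h2 _ hp).2 ⟨g, t, ht, rfl⟩] at this
    · intro h
      obtain ⟨i, hi⟩ := Nat.exists_testBit_of_ne_zero h
      rw [Nat.testBit_and, Bool.and_eq_true] at hi
      have hi32 : i < 32 := by
        by_contra hc
        rw [Nat.testBit_lt_two_pow (lt_of_lt_of_le h1 (Nat.pow_le_pow_right (by norm_num)
          (not_lt.1 hc)))] at hi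
        exact absurd hi.2 (by simp)
      obtain ⟨g, t, ht, rfl⟩ := (h2 i hi32).1 hi.2
      exact ⟨g, D, t, hD, ht, hi.1, rfl⟩
  unfold accepts
  change cond (Nat.beq (S &&& (15 * 16 ^ D * 0x10001)) 0) 1 0 = _
  by_cases h : S &&& (15 * 16 ^ D * 0x10001) = 0
  · rw [h, if_neg (by rw [key]; exact not_not.2 h)]
    rfl
  · rw [if_pos (key.2 h)]
    have : Nat.beq (S &&& (15 * 16 ^ D * 0x10001)) 0 = false := by
      rw [Bool.eq_false_iff]; intro hb; exact h (Nat.eq_of_beq_eq_true hb)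
    rw [this]; rfl

/-- The number of choices of the reorientation bits of the columns with letters `vs` for which no
path starting in the state `S` stays within its budget. -/
def numGood (D : ℕ) : List ℕ → ℕ → ℕ
  | [], S => accepts D S
  | v :: vs, S => numGood D vs (step D v false S) + numGood D vs (step D v true S)

theorem numGood_eq_ncard {D : ℕ} (hD : D < 4) {vs : List ℕ} (hvs : ∀ v ∈ vs, IsLetter v) (S : ℕ) :
    numGood D vs S =
      {xs : List Bool | xs.length = vs.length ∧ ¬ Fails D (vs.zip xs) S}.ncard := by
  induction vs generalizing S with
  | nil =>
    classical
    rw [numGood, accepts_eq hD]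
    simp only [List.length_nil, List.length_eq_zero_iff, List.zip_nil_left]
    split_ifs with h
    · simp [h]
    · have : {xs : List Bool | xs = [] ∧ ¬ Fails D [] S} = {[]} := by
        ext xs; simp [h]
      rw [this, Set.ncard_singleton]
  | cons v vs ih =>
    simp only [List.length_cons]
    rw [ncard_cons, numGood, ih (fun u hu => hvs u (by simp [hu])),
      ih (fun u hu => hvs u (by simp [hu]))]
    simp only [List.zip_cons_cons, fails_step hD (hvs v (by simp))]

theorem numGood_le (D : ℕ) (vs : List ℕ) (S : ℕ) : numGood D vs S ≤ 2 ^ vs.length := by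
  induction vs generalizing S with
  | nil =>
    simp only [numGood, accepts]
    cases Nat.beq (Nat.land S (Nat.mul (Nat.mul 15 (Nat.pow 16 D)) 0x10001)) 0 <;> simp
  | cons v vs ih =>
    have h1 := ih (step D v false S)
    have h2 := ih (step D v true S)
    simp only [numGood, List.length_cons, pow_succ]
    omega

/-- Write the bits `bs` into the letter `v` at the levels `ds`; the unused bits are returned. -/
def fill : List ℕ → ℕ → List Bool → ℕ × List Bool
  | [], v, bs => (v, bs)
  | _ :: _, v, [] => (v, [])
  | _ :: ds, v, false :: bs => fill ds v bs
  | d :: ds, v, true :: bs => fill ds (Nat.lor v (Nat.pow 16 d)) bs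

/-- The letters of the columns whose free levels are listed in `cols`, filled with the bits `bs`. -/
def letters : List (List ℕ) → List Bool → List ℕ
  | [], _ => []
  | ds :: cols, bs => (fill ds 0 bs).1 :: letters cols (fill ds 0 bs).2

/-- Apply `f` after having evaluated its argument to a numeral: the recursor cannot reduce before its
major premise is in weak head normal form. Equal values of the argument thus lead to syntactically
equal terms, which the kernel evaluates only once. -/
def force (f : ℕ → ℕ) (n : ℕ) : ℕ := Nat.rec (f 0) (fun m _ => f (Nat.succ m)) n

theorem force_eq (f : ℕ → ℕ) (n : ℕ) : force f n = f n := by cases n <;> rfl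

/-- Pack `f v` over all ways to fill the free levels `ds` of a letter; each `f v` is itself a packed
family of `2 ^ m` values. -/
def packColumn (f : ℕ → ℕ) (m : ℕ) : List ℕ → ℕ → ℕ
  | [], v => f v
  | d :: ds, v => Nat.add (packColumn f m ds v)
      (Nat.shiftLeft (packColumn f m ds (Nat.lor v (Nat.pow 16 d)))
        (Nat.mul 14 (Nat.pow 2 (Nat.add ds.length m))))

/-- The numbers `numGood` of all ways to fill the columns `cols`, packed. -/
def packedCount (D : ℕ) : List (List ℕ) → ℕ → ℕ
  | [], S => accepts D S
  | ds :: cols, S =>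
    packColumn (fun v => Nat.add (force (packedCount D cols) (step D v false S))
      (force (packedCount D cols) (step D v true S))) (cols.map List.length).sum ds 0

theorem packColumn_eq {f : ℕ → ℕ} {m : ℕ} {H : ℕ × List Bool → ℕ}
    (hf : ∀ v, f v = pack m fun bs => H (v, bs)) (ds : List ℕ) (v : ℕ) :
    packColumn f m ds v = pack (ds.length + m) fun bs => H (fill ds v bs) := by
  induction ds generalizing v with
  | nil => simp [packColumn, fill, hf]
  | cons d ds ih =>
    simp only [packColumn, List.length_cons]
    rw [ih, ih, show ds.length + 1 + m = (ds.length + m) + 1 by omega]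
    change _ + _ <<< (14 * 2 ^ (ds.length + m)) = _
    rw [Nat.shiftLeft_eq, mul_comm]
    rfl

theorem packedCount_eq (D : ℕ) (cols : List (List ℕ)) (S : ℕ) :
    packedCount D cols S =
      pack (cols.map List.length).sum fun bs => numGood D (letters cols bs) S := by
  induction cols generalizing S with
  | nil => rfl
  | cons ds cols ih =>
    simp only [packedCount, letters, List.map_cons, List.sum_cons, numGood]
    refine packColumn_eq (H := fun p => numGood D (letters cols p.2) (step D p.1 false S) +
      numGood D (letters cols p.2) (step D p.1 true S)) (fun v => ?_) ds 0
    rw [force_eq, force_eq, ih, ih]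
    exact pack_add _ _ _

/-! ### Circuits and paths -/

/-- The number of elements of `K` before the position `j`. -/
def countBelow {n : ℕ} (K : Finset (Fin n)) (j : ℕ) : ℕ := (K.filter fun e => e.val < j).card

theorem countBelow_zero {n : ℕ} (K : Finset (Fin n)) : countBelow K 0 = 0 := by
  simp [countBelow]

theorem countBelow_succ {n : ℕ} (K : Finset (Fin n)) (j : Fin n) :
    countBelow K (j + 1) = countBelow K j + if j ∈ K then 1 else 0 := by
  unfold countBelow
  by_cases h : j ∈ K
  · have : K.filter (fun e => e.val < j.val + 1) = insert j (K.filter fun e => e.val < j.val) := by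
      ext e
      simp only [Finset.mem_filter, Finset.mem_insert]
      refine ⟨fun ⟨h1, h2⟩ => ?_, ?_⟩
      · rcases Nat.lt_succ_iff_lt_or_eq.1 h2 with h3 | h3
        · exact Or.inr ⟨h1, h3⟩
        · exact Or.inl (Fin.ext h3)
      · rintro (rfl | ⟨h1, h2⟩)
        · exact ⟨h, by omega⟩
        · exact ⟨h1, by omega⟩
    rw [this, Finset.card_insert_of_notMem (by simp), if_pos h]
  · have : K.filter (fun e => e.val < j.val + 1) = K.filter fun e => e.val < j.val := by
      refine Finset.filter_congr fun e he => ⟨fun h1 => ?_, fun h1 => by omega⟩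
      rcases Nat.lt_succ_iff_lt_or_eq.1 h1 with h3 | h3
      · exact h3
      · exact absurd (Fin.ext h3 ▸ he) h
    rw [this, if_neg h, add_zero]

theorem countBelow_eq_card {n : ℕ} (K : Finset (Fin n)) : countBelow K n = K.card := by
  simp [countBelow]

theorem countBelow_le {n : ℕ} (K : Finset (Fin n)) (j : ℕ) : countBelow K j ≤ K.card :=
  Finset.card_le_card (Finset.filter_subset _ _)

theorem countBelow_orderEmb {m n : ℕ} (J : Fin m ↪o Fin n) (i : Fin m) :
    countBelow (Finset.univ.map J.toEmbedding) (J i) = i := by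
  unfold countBelow
  have : (Finset.univ.map J.toEmbedding).filter (fun e => e.val < (J i).val) =
      (Finset.Iio i).map J.toEmbedding := by
    ext e
    simp only [Finset.mem_filter, Finset.mem_map, Finset.mem_univ, true_and, Finset.mem_Iio]
    constructor
    · rintro ⟨⟨l, rfl⟩, h⟩
      exact ⟨l, J.lt_iff_lt.1 h, rfl⟩
    · rintro ⟨l, hl, rfl⟩
      exact ⟨⟨l, rfl⟩, J.lt_iff_lt.2 hl⟩
  rw [this, Finset.card_map, Fin.card_Iio]

/-- The entries of `A` with the row index shifted by one, and constant rows `1` before the first and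
after the last row. -/
def entry {r n : ℕ} (A : Matrix (Fin r) (Fin n) ℤˣ) : ℕ → Fin n → ℤˣ
  | 0, _ => 1
  | i + 1, j => if h : i < r then A ⟨i, h⟩ j else 1

theorem entry_succ {r n : ℕ} (A : Matrix (Fin r) (Fin n) ℤˣ) (i : Fin r) (j : Fin n) :
    entry A (i + 1) j = A i j := by simp [entry]

/-- A circuit is obtained by scanning the columns from left to right. The carry `g` records the sign
of the next element relative to the matrix entry that precedes it on its row. -/
theorem mem_lawrenceCircuits_iff_scan {r n : ℕ} (A : Matrix (Fin r) (Fin n) ℤˣ)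
    (X : Fin n → SignType) : X ∈ lawrenceCircuits A ↔
      ∃ (K : Finset (Fin n)) (g : ℕ → ℤˣ), K.card = r + 1 ∧
        (∀ j ∈ K, X j = unitSign (g j * entry A (countBelow K j) j) ∧
          g (j + 1) = -(g j * entry A (countBelow K j) j * entry A (countBelow K j + 1) j)) ∧
        ∀ j ∉ K, X j = 0 ∧ g (j + 1) = g j := by
  rw [mem_lawrenceCircuits]
  constructor
  · rintro ⟨J, s, h1, h2, h3⟩
    have hmem : ∀ j, j ∈ Finset.univ.map J.toEmbedding ↔ j ∈ Set.range J := by intro j; simp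
    let K := Finset.univ.map J.toEmbedding
    -- Once all elements are passed the carry is fixed by the constant last row of `entry`.
    let g : ℕ → ℤˣ := fun m => if h : countBelow K m < r + 1 then
      s ⟨countBelow K m, h⟩ * entry A (countBelow K m) (J ⟨countBelow K m, h⟩)
      else -s (Fin.last r)
    have hg : ∀ (m : ℕ) (i : Fin (r + 1)), countBelow K m = i → g m = s i * entry A i (J i) := by
      intro m i hm
      have : countBelow K m < r + 1 := by omega
      simp only [g, this, dif_pos]
      have e : (⟨countBelow K m, this⟩ : Fin (r + 1)) = i := Fin.ext hm
      rw [e, hm]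
    refine ⟨K, g, by simp [K], fun j hj => ?_, fun j hj => ?_⟩
    · obtain ⟨i, rfl⟩ := (hmem j).1 hj
      have hc : countBelow K (J i) = i := countBelow_orderEmb J i
      have hc' : countBelow K (J i + 1) = i + 1 := by rw [countBelow_succ, hc, if_pos hj]
      rw [hg _ i hc, hc]
      have hsq : s i * entry A i (J i) * entry A i (J i) = s i := by
        rw [mul_assoc, Int.units_mul_self, mul_one]
      rw [hsq]
      refine ⟨h1 i, ?_⟩
      induction i using Fin.lastCases with
      | last =>
        have : ¬ countBelow K (J (Fin.last r) + 1) < r + 1 := by rw [hc']; simp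
        simp only [g, this, dif_neg, not_false_eq_true]
        simp [entry]
      | cast i =>
        rw [hg _ i.succ (by rw [hc']; simp)]
        rw [Fin.val_succ, entry_succ, Fin.val_castSucc, entry_succ]
        exact h3 i
    · refine ⟨h2 j fun h => hj ((hmem j).2 h), ?_⟩
      have : countBelow K (j + 1) = countBelow K j := by rw [countBelow_succ, if_neg hj, add_zero]
      simp only [g, this]
  · rintro ⟨K, g, hK, h1, h2⟩
    let J := K.orderEmbOfFin hK
    have hJK : Finset.univ.map J.toEmbedding = K := by
      ext e
      have := Set.ext_iff.1 (Finset.range_orderEmbOfFin K hK) e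
      rw [Set.mem_range, Finset.mem_coe] at this
      rw [Finset.mem_map, ← this]
      simp [J]
    have hmem : ∀ i, J i ∈ K := fun i => Finset.orderEmbOfFin_mem K hK i
    have hc : ∀ i, countBelow K (J i) = i := fun i => by
      conv_lhs => rw [← hJK]
      exact countBelow_orderEmb J i
    refine ⟨J, fun i => g (J i) * entry A i (J i), fun i => ?_, fun e he => ?_, fun i => ?_⟩
    · rw [(h1 _ (hmem i)).1, hc]
    · refine (h2 e fun h => he ?_).1
      have := Finset.range_orderEmbOfFin K hK
      rw [this]
      exact h
    · have hconst : ∀ m, (J i.castSucc).val + 1 ≤ m → m ≤ J i.succ →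
          g m = g (J i.castSucc + 1) := by
        intro m hm
        induction m, hm using Nat.le_induction with
        | base => exact fun _ => rfl
        | succ m hm ih =>
          intro hm'
          rw [← ih (by omega)]
          refine (h2 ⟨m, by omega⟩ fun hmK => ?_).2
          obtain ⟨l, -, hl⟩ := Finset.mem_map.1 (hJK.symm.le hmK)
          have a1 : i.castSucc < l := J.lt_iff_lt.1 (by
            rw [Fin.lt_def]; change _ < (J.toEmbedding l).val; rw [hl]; exact hm)
          have a2 : l < i.succ := J.lt_iff_lt.1 (by
            rw [Fin.lt_def]; change (J.toEmbedding l).val < _; rw [hl]; exact hm')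
          rw [Fin.lt_def] at a1 a2
          simp at a1 a2
          omega
      have hlt : J i.castSucc < J i.succ := J.lt_iff_lt.2 (by rw [Fin.lt_def]; simp)
      have e1 := (h1 _ (hmem i.castSucc)).2
      rw [hc, Fin.val_castSucc, entry_succ] at e1
      change g (J i.succ) * entry A (i + 1) (J i.succ) * A i (J i.succ) =
        -(g (J i.castSucc) * entry A i (J i.castSucc) * A i (J i.castSucc))
      rw [entry_succ, mul_assoc, Int.units_mul_self, mul_one, hconst _ hlt le_rfl, e1]

/-- One move of a path reading the column with letter `v` and reorientation bit `x`, from the level,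
carry and budget `p` to those of `q`: the column is kept or deleted. -/
def Move (v : ℕ) (x : Bool) (p q : ℕ × Bool × ℕ) : Prop :=
  (q.1 = p.1 ∧ q.2.1 = !(p.2.1 ^^ v.testBit (4 * p.1) ^^ (16 * v).testBit (4 * p.1)) ∧
    p.2.2 = q.2.2 + (p.2.1 ^^ v.testBit (4 * p.1) ^^ x).toNat) ∨
  (q.1 = p.1 + 1 ∧ q.2 = p.2)

theorem hasLightPath_cons {D v : ℕ} {x : Bool} {w : List (ℕ × Bool)} {d : ℕ} {g : Bool} {t : ℕ} :
    HasLightPath D ((v, x) :: w) d g t ↔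
      ∃ q, Move v x (d, g, t) q ∧ HasLightPath D w q.1 q.2.1 q.2.2 := by
  simp only [HasLightPath, Move]
  constructor
  · rintro (h | h)
    · split_ifs at h with hm
      · refine ⟨(d, _, t - 1), Or.inl ⟨rfl, rfl, ?_⟩, h.2⟩
        rw [hm]
        have := h.1
        simp only [Bool.toNat_true]
        omega
      · refine ⟨(d, _, t), Or.inl ⟨rfl, rfl, ?_⟩, h⟩
        rw [Bool.not_eq_true] at hm
        rw [hm]; rfl
    · exact ⟨(d + 1, g, t), Or.inr ⟨rfl, rfl⟩, h⟩
  · rintro ⟨⟨d', g', t'⟩, ⟨h1, h2, h3⟩ | ⟨h1, h2⟩, h⟩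
    · simp only at h1 h2 h3 h
      subst h1 h2 h3
      left
      split_ifs with hm
      · rw [hm]
        exact ⟨by simp, by simpa using h⟩
      · rw [Bool.not_eq_true] at hm
        rw [hm]
        exact h
    · simp only [Prod.mk.injEq] at h1 h2 h
      obtain ⟨rfl, rfl⟩ := h2
      subst h1
      exact Or.inr h

/-- A light path, given by the sequence of its levels, carries and remaining budgets. -/
theorem hasLightPath_range' {D : ℕ} {V : ℕ → ℕ} {x : ℕ → Bool} {len m : ℕ} {p : ℕ × Bool × ℕ} :
    HasLightPath D ((List.range' m len).map fun j => (V j, x j)) p.1 p.2.1 p.2.2 ↔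
      ∃ σ : ℕ → ℕ × Bool × ℕ, σ m = p ∧ (σ (m + len)).1 = D ∧
        ∀ j, m ≤ j → j < m + len → Move (V j) (x j) (σ j) (σ (j + 1)) := by
  induction len generalizing m p with
  | zero =>
    simp only [List.range'_zero, List.map_nil, HasLightPath, add_zero]
    refine ⟨fun h => ⟨fun _ => p, rfl, h, fun j h1 h2 => by omega⟩, ?_⟩
    rintro ⟨σ, rfl, h, -⟩
    exact h
  | succ len ih =>
    rw [List.range'_succ, List.map_cons, hasLightPath_cons]
    constructor
    · rintro ⟨q, hq, h⟩
      obtain ⟨σ, h1, h2, h3⟩ := ih.1 h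
      refine ⟨Function.update σ m p, by simp, ?_, fun j hj hj' => ?_⟩
      · rw [Function.update_of_ne (by omega), ← h2]
        congr 2; omega
      · rw [Function.update_of_ne (a := j + 1) (by omega)]
        rcases eq_or_lt_of_le hj with rfl | hlt
        · rw [Function.update_self, h1]
          exact hq
        · rw [Function.update_of_ne (by omega)]
          exact h3 j (by omega) (by omega)
    · rintro ⟨σ, rfl, h2, h3⟩
      refine ⟨σ (m + 1), h3 m le_rfl (by omega), ih.2 ⟨σ, rfl, ?_, fun j h4 h5 => ?_⟩⟩
      · rw [← h2]
        congr 2; omega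
      · exact h3 j (by omega) (by omega)

/-- The sign `-1` for `true` and `1` for `false`. -/
def boolSign (b : Bool) : ℤˣ := if b then -1 else 1

theorem boolSign_xor (a b : Bool) : boolSign (a ^^ b) = boolSign a * boolSign b := by
  cases a <;> cases b <;> rfl

theorem boolSign_not (a : Bool) : boolSign (!a) = -boolSign a := by cases a <;> rfl

theorem boolSign_surjective : Function.Surjective boolSign := by
  intro u
  rcases Int.units_eq_one_or u with rfl | rfl
  · exact ⟨false, rfl⟩
  · exact ⟨true, rfl⟩

theorem boolSign_injective : Function.Injective boolSign := by decide

theorem neg_signs_iff (b : Bool) : (unitSign (boolSign b) = -1 ↔ b = true) ∧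
    (-unitSign (boolSign b) = -1 ↔ b = false) := by
  cases b <;> decide

/-- Since the negative of a circuit is a circuit, it is enough to count negative elements. -/
theorem isNeighborly_iff {E : Type*} [DecidableEq E] [Fintype E] (M : OrientedMatroid E) (k : ℕ) :
    M.IsNeighborly k ↔ ∀ X ∈ M.circuits, k < (Finset.univ.filter fun e => X e = -1).card := by
  refine ⟨fun h X hX => (h X hX).2, fun h X hX => ⟨?_, h X hX⟩⟩
  have := h _ (M.neg_mem X hX)
  simpa [neg_eq_iff_eq_neg] using this

/-- The letters `V` code the matrix `A`: in the column `j`, the entry met at level `d`, that is,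
after `j - d` kept columns, is the bit `4 * d` of `V j`, and the entry on the following row is the
bit `4 * (d - 1)`. -/
def Codes {r n : ℕ} (D : ℕ) (V : ℕ → ℕ) (A : Matrix (Fin r) (Fin n) ℤˣ) : Prop :=
  ∀ (j : Fin n) (d i : ℕ), d ≤ D → i ≤ r → d + i = j →
    boolSign ((V j).testBit (4 * d)) = entry A i j ∧
    boolSign ((16 * V j).testBit (4 * d)) = entry A (i + 1) j

/-- A reorientation is not `k`-neighborly if and only if some path collects at most `k` negative
signs. A circuit with kept set `K` corresponds to the path whose level is the number of columns
deleted so far. -/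
theorem not_isNeighborly_reorient_iff {r n D : ℕ} (hn : n = r + 1 + D)
    {A : Matrix (Fin r) (Fin n) ℤˣ} {V : ℕ → ℕ} (hV : Codes D V A) {M : OrientedMatroid (Fin n)}
    (hM : M.circuits = lawrenceCircuits A) (R : Finset (Fin n)) (x : ℕ → Bool)
    (hx : ∀ j : Fin n, x j = decide (j ∈ R)) (k : ℕ) :
    ¬ (M.reorient R).IsNeighborly k ↔
      ∃ g, HasLightPath D ((List.range' 0 n).map fun j => (V j, x j)) 0 g k := by
  have hneg : ∀ (X : Fin n → SignType) (j : Fin n) (b : Bool), X j = unitSign (boolSign b) →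
      (reorientVec R X j = -1 ↔ (b ^^ x j) = true) := by
    intro X j b h
    rw [hx]
    by_cases hj : j ∈ R
    · simp only [reorientVec, hj, if_true, h, (neg_signs_iff b).2]
      simp
    · simp only [reorientVec, hj, if_false, h, (neg_signs_iff b).1]
      simp
  have hneg0 : ∀ (X : Fin n → SignType) (j : Fin n), X j = 0 → reorientVec R X j ≠ -1 := by
    intro X j h
    simp only [reorientVec, h, neg_zero, ite_self]
    decide
  rw [isNeighborly_iff]
  push Not
  constructor
  · rintro ⟨_, ⟨X, hX, rfl⟩, hk⟩
    rw [hM, mem_lawrenceCircuits_iff_scan] at hX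
    obtain ⟨K, g, hK, h1, h2⟩ := hX
    choose b hb using boolSign_surjective
    let N := Finset.univ.filter fun e => reorientVec R X e = -1
    have hN : ∀ e, e ∈ N ↔ reorientVec R X e = -1 := by intro e; simp [N]
    have hkN : N.card ≤ k := hk
    have hcompl : (Finset.univ \ K).card = D := by
      rw [Finset.card_sdiff_of_subset (Finset.subset_univ _), Finset.card_univ, Fintype.card_fin]
      omega
    have hsum : ∀ j ≤ n, countBelow K j + countBelow (Finset.univ \ K) j = j := by
      intro j
      induction j with
      | zero => intro _; simp [countBelow_zero]
      | succ j ih =>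
        intro hj
        have e1 := countBelow_succ K ⟨j, hj⟩
        have e2 := countBelow_succ (Finset.univ \ K) ⟨j, hj⟩
        simp only [Finset.mem_sdiff, Finset.mem_univ, true_and] at e1 e2
        have := ih (by omega)
        split_ifs at e1 e2 <;> omega
    refine ⟨b (g 0), hasLightPath_range' (p := (0, b (g 0), k)).2
      ⟨fun j => (countBelow (Finset.univ \ K) j, b (g j), k - countBelow N j), ?_, ?_, ?_⟩⟩
    · simp [countBelow_zero]
    · simp only [zero_add, countBelow_eq_card, hcompl]
    · intro j _ hj
      rw [zero_add] at hj
      have eK := countBelow_succ K ⟨j, hj⟩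
      have eC := countBelow_succ (Finset.univ \ K) ⟨j, hj⟩
      have eN := countBelow_succ N ⟨j, hj⟩
      have lN := countBelow_le N (j + 1)
      have hs := hsum j hj.le
      simp only [Finset.mem_sdiff, Finset.mem_univ, true_and, hN] at eC eN
      by_cases hjK : (⟨j, hj⟩ : Fin n) ∈ K
      · obtain ⟨e1, e2⟩ := h1 _ hjK
        have hlt : countBelow K j < r + 1 := by
          have := countBelow_le K (j + 1)
          simp only [if_pos hjK] at eK
          omega
        obtain ⟨c1, c2⟩ := hV ⟨j, hj⟩ (countBelow (Finset.univ \ K) j) (countBelow K j)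
          (hcompl ▸ countBelow_le _ _) (by omega) (by simp only; omega)
        simp only at e1 e2 c1 c2
        rw [← c1, ← hb (g j), ← boolSign_xor] at e1
        refine Or.inl ⟨?_, ?_, ?_⟩
        · simp only [eC, hjK, not_true_eq_false, if_false, add_zero]
        · apply boolSign_injective
          rw [boolSign_not, boolSign_xor, boolSign_xor, hb, hb, e2]
          simp only [c1, c2]
        · have e3 := hneg X _ _ e1
          simp only at e3 ⊢
          by_cases hm : (b (g j) ^^ (V j).testBit (4 * countBelow (Finset.univ \ K) j) ^^ x j) = true
          · rw [hm, Bool.toNat_true]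
            rw [if_pos (e3.2 hm)] at eN
            omega
          · rw [if_neg fun h => hm (e3.1 h)] at eN
            rw [Bool.not_eq_true] at hm
            rw [hm, Bool.toNat_false]
            omega
      · obtain ⟨e1, e2⟩ := h2 _ hjK
        rw [if_neg (hneg0 X _ e1), add_zero] at eN
        rw [if_pos hjK] at eC
        refine Or.inr ⟨eC, ?_⟩
        simp only [eN]
        rw [show g (j + 1) = g j from e2]
  · rintro ⟨g, hg⟩
    obtain ⟨σ, h0, hD, hmove⟩ := hasLightPath_range' (p := (0, g, k)).1 hg
    rw [zero_add] at hD
    simp only [zero_add, Nat.zero_le, true_implies] at hmove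
    let K : Finset (Fin n) := Finset.univ.filter fun e => (σ (e + 1)).1 = (σ e).1
    have hmem : ∀ e : Fin n, e ∈ K ↔ (σ (e + 1)).1 = (σ e).1 := by intro e; simp [K]
    have hlev : ∀ j ≤ n, (σ j).1 + countBelow K j = j := by
      intro j
      induction j with
      | zero => intro _; simp [countBelow_zero, h0]
      | succ j ih =>
        intro hj
        have e1 := countBelow_succ K ⟨j, hj⟩
        simp only [hmem] at e1
        have := ih (by omega)
        rcases hmove j hj with ⟨h, -⟩ | ⟨h, -⟩
        · rw [if_pos h] at e1
          omega
        · rw [if_neg (by omega)] at e1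
          omega
    have hlevle : ∀ j ≤ n, (σ j).1 ≤ D := by
      intro j hj
      induction hj using Nat.decreasingInduction with
      | of_succ j hj ih =>
        rcases hmove j hj with ⟨h, -⟩ | ⟨h, -⟩ <;> omega
      | self => exact hD.le
    have hcard : K.card = r + 1 := by
      have := hlev n le_rfl
      rw [countBelow_eq_card] at this
      omega
    let X : Fin n → SignType := fun e =>
      if e ∈ K then unitSign (boolSign ((σ e).2.1 ^^ (V e).testBit (4 * (σ e).1))) else 0
    have hcode : ∀ e ∈ K, boolSign ((V e).testBit (4 * (σ e).1)) = entry A (countBelow K e) e ∧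
        boolSign ((16 * V e).testBit (4 * (σ e).1)) = entry A (countBelow K e + 1) e := by
      intro e he
      refine hV e _ _ (hlevle e e.2.le) ?_ (hlev e e.2.le)
      have e1 := countBelow_succ K e
      have := countBelow_le K (e + 1)
      rw [if_pos he] at e1
      omega
    have hkeep : ∀ e ∈ K, (σ (e + 1)).2.1 =
          !((σ e).2.1 ^^ (V e).testBit (4 * (σ e).1) ^^ (16 * V e).testBit (4 * (σ e).1)) ∧
        (σ e).2.2 = (σ (e + 1)).2.2 + ((σ e).2.1 ^^ (V e).testBit (4 * (σ e).1) ^^ x e).toNat := by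
      intro e he
      rw [hmem] at he
      rcases hmove e e.2 with ⟨-, h⟩ | ⟨h, -⟩
      · exact h
      · omega
    have hdel : ∀ e ∉ K, (σ (e + 1)).2 = (σ e).2 := by
      intro e he
      rw [hmem] at he
      rcases hmove e e.2 with ⟨h, -⟩ | ⟨-, h⟩
      · exact absurd h he
      · exact h
    have hbudget : ∀ j ≤ n, (σ j).2.2 +
        countBelow (Finset.univ.filter fun e => reorientVec R X e = -1) j = k := by
      intro j
      induction j with
      | zero => intro _; simp [countBelow_zero, h0]
      | succ j ih =>
        intro hj
        have e1 := countBelow_succ (Finset.univ.filter fun e => reorientVec R X e = -1) ⟨j, hj⟩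
        simp only [Finset.mem_filter, Finset.mem_univ, true_and] at e1
        have := ih (by omega)
        by_cases he : (⟨j, hj⟩ : Fin n) ∈ K
        · have e2 := (hkeep _ he).2
          have e3 := hneg X ⟨j, hj⟩ _ (if_pos he)
          simp only at e2 e3
          by_cases hm : ((σ j).2.1 ^^ (V j).testBit (4 * (σ j).1) ^^ x j) = true
          · rw [hm, Bool.toNat_true] at e2
            rw [if_pos (e3.2 hm)] at e1
            omega
          · rw [if_neg fun h => hm (e3.1 h)] at e1
            rw [Bool.not_eq_true] at hm
            rw [hm, Bool.toNat_false] at e2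
            omega
        · have e2 := hdel _ he
          rw [if_neg (hneg0 X _ (if_neg he))] at e1
          simp only at e2
          rw [e2]
          omega
    refine ⟨_, ⟨X, ?_, rfl⟩, ?_⟩
    · rw [hM, mem_lawrenceCircuits_iff_scan]
      refine ⟨K, fun j => boolSign (σ j).2.1, hcard, fun j hj => ⟨?_, ?_⟩,
        fun j hj => ⟨if_neg hj, ?_⟩⟩
      · simp only [X, hj, if_true]
        rw [boolSign_xor, (hcode j hj).1]
      · rw [← (hcode j hj).1, ← (hcode j hj).2]
        simp only [(hkeep j hj).1, boolSign_not, boolSign_xor]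
      · simp only [hdel j hj]
    · have := hbudget n le_rfl
      rw [countBelow_eq_card] at this
      omega

/-! ### Reorientation and the normal form -/

section Reorientation

variable {E : Type*} [DecidableEq E]

theorem reorientVec_reorientVec (R S : Finset E) (X : E → SignType) :
    reorientVec R (reorientVec S X) = reorientVec (symmDiff S R) X := by
  funext e
  by_cases h1 : e ∈ R <;> by_cases h2 : e ∈ S <;>
    simp [reorientVec, h1, h2, Finset.mem_symmDiff]

theorem reorient_reorient (M : OrientedMatroid E) (R S : Finset E) :
    (M.reorient S).reorient R = M.reorient (symmDiff S R) := by
  ext X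
  simp only [reorient, Set.image_image, reorientVec_reorientVec]

theorem reorient_empty (M : OrientedMatroid E) : M.reorient ∅ = M := by
  ext X
  have : reorientVec (∅ : Finset E) = id := by funext X e; simp [reorientVec]
  simp [reorient, this]

theorem mem_reorientationClass_self (M : OrientedMatroid E) : M ∈ M.reorientationClass :=
  ⟨∅, reorient_empty M⟩

theorem reorientationClass_reorient (M : OrientedMatroid E) (S : Finset E) :
    (M.reorient S).reorientationClass = M.reorientationClass := by
  ext N
  constructor
  · rintro ⟨R, rfl⟩
    exact ⟨symmDiff S R, (reorient_reorient M R S).symm⟩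
  · rintro ⟨R, rfl⟩
    exact ⟨symmDiff S R, by rw [reorient_reorient, symmDiff_symmDiff_cancel_left]⟩

theorem numNeighborly_reorient [Fintype E] (M : OrientedMatroid E) (S : Finset E) (k : ℕ) :
    (M.reorient S).numNeighborly k = M.numNeighborly k := by
  unfold numNeighborly
  rw [← Set.ncard_image_of_injective {R : Finset E | ((M.reorient S).reorient R).IsNeighborly k}
    (symmDiff_right_injective S)]
  congr 1
  ext R
  simp only [Set.mem_image, Set.mem_ofPred_eq, reorient_reorient]
  constructor
  · rintro ⟨R, h, rfl⟩
    exact h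
  · intro h
    exact ⟨symmDiff S R, by rwa [symmDiff_symmDiff_cancel_left], symmDiff_symmDiff_cancel_left S R⟩

end Reorientation

section Invariance

variable {r n : ℕ}

/-- The matrix `A` with the columns in `R` negated. -/
def negCols (A : Matrix (Fin r) (Fin n) ℤˣ) (R : Finset (Fin n)) : Matrix (Fin r) (Fin n) ℤˣ :=
  fun i j => if j ∈ R then -A i j else A i j

theorem reorientVec_mem_lawrenceCircuits {A : Matrix (Fin r) (Fin n) ℤˣ} {X : Fin n → SignType}
    (R : Finset (Fin n)) (hX : X ∈ lawrenceCircuits A) :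
    reorientVec R X ∈ lawrenceCircuits (negCols A R) := by
  rw [mem_lawrenceCircuits] at hX ⊢
  obtain ⟨J, s, h1, h2, h3⟩ := hX
  have hmul : ∀ (i : Fin (r + 1)) (l : Fin r),
      (if J i ∈ R then -s i else s i) * negCols A R l (J i) = s i * A l (J i) := by
    intro i l
    unfold negCols
    split_ifs <;> simp
  refine ⟨J, fun i => if J i ∈ R then -s i else s i, fun i => ?_, fun e he => ?_, fun i => ?_⟩
  · simp only [reorientVec, h1]
    split_ifs
    · generalize s i = u
      revert u
      decide
    · rfl
  · simp [reorientVec, h2 e he]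
  · simp only [hmul, h3]

theorem negCols_negCols (A : Matrix (Fin r) (Fin n) ℤˣ) (R : Finset (Fin n)) :
    negCols (negCols A R) R = A := by
  funext i j
  by_cases h : j ∈ R <;> simp [negCols, h]

theorem reorient_lawrence (A : Matrix (Fin r) (Fin n) ℤˣ) (R : Finset (Fin n)) :
    (lawrence A).reorient R = lawrence (negCols A R) := by
  ext X
  constructor
  · rintro ⟨X, hX, rfl⟩
    exact reorientVec_mem_lawrenceCircuits R hX
  · intro hX
    refine ⟨reorientVec R X, ?_, ?_⟩
    · have := reorientVec_mem_lawrenceCircuits R hX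
      rwa [negCols_negCols] at this
    · rw [reorientVec_reorientVec, symmDiff_self]
      funext e
      simp [reorientVec]

theorem orderEmb_add_le {m : ℕ} (J : Fin m ↪o Fin n) {l l' : Fin m} (h : l ≤ l') :
    (J l).val + (l' - l) ≤ J l' := by
  obtain ⟨l', hl'⟩ := l'
  induction l' with
  | zero =>
    have : l = ⟨0, hl'⟩ := le_antisymm h (Nat.zero_le _)
    subst this
    simp
  | succ l' ih =>
    rcases eq_or_lt_of_le h with rfl | hlt
    · simp
    · have h1 : l.val ≤ l' := Nat.lt_succ_iff.1 hlt
      have h2 := ih (by omega) h1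
      have h3 : J ⟨l', by omega⟩ < J ⟨l' + 1, hl'⟩ := J.lt_iff_lt.2 (by simp [Fin.lt_def])
      rw [Fin.lt_def] at h3
      simp only at h2 ⊢
      omega

theorem le_orderEmb (J : Fin (r + 1) ↪o Fin n) (l : Fin (r + 1)) : l.val ≤ J l := by
  have := orderEmb_add_le J (Fin.zero_le l)
  simp only [Fin.val_zero] at this
  omega

theorem orderEmb_add_le_add (J : Fin (r + 1) ↪o Fin n) (l : Fin (r + 1)) :
    (J l).val + r + 1 ≤ n + l := by
  have := orderEmb_add_le J (Fin.le_last l)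
  have h := (J (Fin.last r)).2
  simp only [Fin.val_last] at this
  omega

/-- Only the entries `A i j` with `i ≤ j ≤ i + n - r` matter, and only up to the signs of the
rows. -/
theorem lawrenceCircuits_subset {A A' : Matrix (Fin r) (Fin n) ℤˣ} (ρ : Fin r → ℤˣ)
    (h : ∀ (i : Fin r) (j : Fin n), i.val ≤ j → j.val + r ≤ i + n → A' i j = ρ i * A i j) :
    lawrenceCircuits A ⊆ lawrenceCircuits A' := by
  intro X hX
  rw [mem_lawrenceCircuits] at hX ⊢
  obtain ⟨J, s, h1, h2, h3⟩ := hX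
  refine ⟨J, s, h1, h2, fun i => ?_⟩
  have a1 := le_orderEmb J i.succ
  have a2 := le_orderEmb J i.castSucc
  have a3 := orderEmb_add_le_add J i.succ
  have a4 := orderEmb_add_le_add J i.castSucc
  simp only [Fin.val_succ, Fin.val_castSucc] at a1 a2 a3 a4
  rw [h i (J i.succ) (by omega) (by omega), h i (J i.castSucc) (by omega) (by omega),
    mul_left_comm, h3 i, mul_neg, mul_left_comm]

theorem lawrence_eq_of_row_signs {A A' : Matrix (Fin r) (Fin n) ℤˣ} (ρ : Fin r → ℤˣ)
    (h : ∀ (i : Fin r) (j : Fin n), i.val ≤ j → j.val + r ≤ i + n → A' i j = ρ i * A i j) :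
    lawrence A = lawrence A' := by
  ext X
  refine ⟨fun hX => lawrenceCircuits_subset ρ h hX, fun hX => lawrenceCircuits_subset ρ ?_ hX⟩
  intro i j h1 h2
  rw [h i j h1 h2, ← mul_assoc, Int.units_mul_self, one_mul]

theorem unitSign_injective : Function.Injective unitSign := by
  intro u v
  revert u v
  decide

/-- Every `r + 1` elements support a circuit. -/
theorem exists_circuit (A : Matrix (Fin r) (Fin n) ℤˣ) (J : Fin (r + 1) ↪o Fin n) :
    ∃ s : Fin (r + 1) → ℤˣ, (∀ i : Fin r,
      s i.succ * A i (J i.succ) = -(s i.castSucc * A i (J i.castSucc))) ∧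
      ∃ X ∈ lawrenceCircuits A, (∀ i, X (J i) = unitSign (s i)) ∧
        ∀ e, e ∉ Set.range J → X e = 0 := by
  let s : Fin (r + 1) → ℤˣ := Fin.induction 1
    fun i t => -(t * A i (J i.castSucc) * A i (J i.succ))
  have hs : ∀ i : Fin r, s i.succ * A i (J i.succ) = -(s i.castSucc * A i (J i.castSucc)) := by
    intro i
    have : s i.succ = -(s i.castSucc * A i (J i.castSucc) * A i (J i.succ)) := rfl
    rw [this, neg_mul, mul_assoc, Int.units_mul_self, mul_one]
  classical
  let X : Fin n → SignType := fun e => if h : ∃ i, J i = e then unitSign (s h.choose) else 0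
  have h1 : ∀ i, X (J i) = unitSign (s i) := by
    intro i
    have h : ∃ l, J l = J i := ⟨i, rfl⟩
    simp only [X, h, dif_pos]
    rw [J.injective h.choose_spec]
  have h2 : ∀ e, e ∉ Set.range J → X e = 0 := fun e he => dif_neg he
  exact ⟨s, hs, X, (mem_lawrenceCircuits A X).2 ⟨J, s, h1, h2, hs⟩, h1, h2⟩

/-- The circuit through two elements `j < j'` that are consecutive in it and meet on the row `i`
recovers the product of the two entries of that row. -/
theorem mul_eq_mul_of_lawrence_eq {A A' : Matrix (Fin r) (Fin n) ℤˣ}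
    (h : lawrence A = lawrence A') (i : Fin r) {j j' : Fin n} (h1 : i.val ≤ j) (h2 : j < j')
    (h3 : j'.val + r ≤ i + n) : A i j * A i j' = A' i j * A' i j' := by
  have hj := j.2
  have hj' := j'.2
  rw [Fin.lt_def] at h2
  let f : Fin (r + 1) → Fin n := fun l =>
    if l.val < i then ⟨l, by omega⟩ else if l.val = i then j else if l.val = i + 1 then j'
    else ⟨l + (n - r - 1), by omega⟩
  have hf : StrictMono f := by
    intro l l' hl
    rw [Fin.lt_def] at hl ⊢
    simp only [f]
    have := l.2
    have := l'.2
    split_ifs <;> first | omega | (simp only; omega)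
  let J : Fin (r + 1) ↪o Fin n := OrderEmbedding.ofStrictMono f hf
  have e1 : J i.castSucc = j := by simp [J, f]
  have e2 : J i.succ = j' := by simp [J, f]
  obtain ⟨s, hs, X, hX, hX1, hX2⟩ := exists_circuit A J
  have hX' : X ∈ lawrenceCircuits A' := by
    have : X ∈ (lawrence A).circuits := hX
    rw [h] at this
    exact this
  rw [mem_lawrenceCircuits] at hX'
  obtain ⟨K, t, hK1, hK2, hK3⟩ := hX'
  have hu : ∀ u : ℤˣ, unitSign u ≠ 0 := by decide
  have hr : Set.range J = Set.range K := by
    ext e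
    constructor
    · rintro ⟨l, rfl⟩
      by_contra hc
      exact hu _ ((hX1 l).symm.trans (hK2 _ hc))
    · rintro ⟨l, rfl⟩
      by_contra hc
      exact hu _ ((hK1 l).symm.trans (hX2 _ hc))
  have hJK : J = K := DFunLike.coe_injective ((StrictMono.range_inj J.strictMono K.strictMono).1 hr)
  subst hJK
  have hst : s = t := by
    funext l
    exact unitSign_injective ((hX1 l).symm.trans (hK1 l))
  subst hst
  have a1 := hs i
  have a2 := hK3 i
  rw [e1, e2] at a1 a2
  have key : ∀ u v a b a' b' : ℤˣ, u * b = -(v * a) → u * b' = -(v * a') → a * b = a' * b' := by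
    decide
  exact key _ _ _ _ _ _ a1 a2

/-- A normal form for sign matrices under negation of rows and columns. Entries below the diagonal or
more than `n - r` places to its right are irrelevant for the circuits and not restricted. -/
structure IsNormal (A : Matrix (Fin r) (Fin n) ℤˣ) : Prop where
  diag : ∀ (i : Fin r) (j : Fin n), j.val = i → A i j = 1
  super : ∀ (i : Fin r) (j : Fin n), j.val = i + 1 → A i j = 1
  last : ∀ (i : Fin r) (j : Fin n), i.val + 1 = r → i.val ≤ j → A i j = 1

theorem exists_isNormal (A : Matrix (Fin r) (Fin n) ℤˣ) :
    ∃ (R : Finset (Fin n)) (A' : Matrix (Fin r) (Fin n) ℤˣ), IsNormal A' ∧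
      (lawrence A).reorient R = lawrence A' := by
  let a : ℕ → ℕ → ℤˣ := fun i j => if h : i < r ∧ j < n then A ⟨i, h.1⟩ ⟨j, h.2⟩ else 1
  have ha : ∀ (i : Fin r) (j : Fin n), A i j = a i j := by intro i j; simp [a]
  -- The signs of the first `r + 1` columns are forced along the staircase of the entries
  -- `(i, i)`, `(i, i + 1)`, those of the remaining columns by the last row.
  let p : ℕ → ℤˣ := fun j => ∏ l ∈ Finset.range j, a l l * a l (l + 1)
  let x : ℕ → ℤˣ := fun j => if j ≤ r then p j else p (r - 1) * a (r - 1) (r - 1) * a (r - 1) j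
  let ρ : ℕ → ℤˣ := fun i => p i * a i i
  have hp : ∀ i, p (i + 1) = p i * (a i i * a i (i + 1)) := fun i => Finset.prod_range_succ _ _
  have hu : ∀ u v w : ℤˣ, u * v * (u * v) = 1 ∧ u * v * (u * (v * w) * w) = 1 ∧
      u * v * (u * v * w * w) = 1 := by decide
  refine ⟨Finset.univ.filter fun j => x j = -1, fun i j => ρ i * (x j * A i j), ⟨?_, ?_, ?_⟩, ?_⟩
  · intro i j hij
    have : x j = p i := by simp only [x]; rw [if_pos (by omega), hij]
    rw [ha, this, hij]
    exact (hu _ _ 1).1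
  · intro i j hij
    have : x j = p i * (a i i * a i (i + 1)) := by
      simp only [x]; rw [if_pos (by omega), hij, hp]
    rw [ha, this, hij]
    exact (hu _ _ _).2.1
  · intro i j hi hij
    by_cases hj : j.val ≤ r
    · rcases (show j.val = i ∨ j.val = i + 1 by omega) with h | h
      · have : x j = p i := by simp only [x]; rw [if_pos hj, h]
        rw [ha, this, h]
        exact (hu _ _ 1).1
      · have : x j = p i * (a i i * a i (i + 1)) := by simp only [x]; rw [if_pos hj, h, hp]
        rw [ha, this, h]
        exact (hu _ _ _).2.1
    · have : x j = p i * a i i * a i j := by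
        simp only [x]; rw [if_neg hj, show r - 1 = i by omega]
      rw [ha, this]
      exact (hu _ _ _).2.2
  · rw [reorient_lawrence]
    refine lawrence_eq_of_row_signs (fun i => ρ i) fun i j _ _ => ?_
    congr 1
    simp only [negCols, Finset.mem_filter, Finset.mem_univ, true_and]
    split_ifs with h
    · rw [h]; simp
    · rw [(Int.units_eq_one_or (x j)).resolve_right h, one_mul]

/-- The reorientation class determines the relevant entries of a matrix in normal form: the prescribed
entries force the reoriented columns to be all columns or none. -/
theorem IsNormal.eq_of_mem_reorientationClass (hrn : r < n) {A A' : Matrix (Fin r) (Fin n) ℤˣ}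
    (hA : IsNormal A) (hA' : IsNormal A')
    (h : lawrence A' ∈ (lawrence A).reorientationClass) (i : Fin r) (j : Fin n)
    (h1 : i.val ≤ j) (h2 : j.val + r ≤ i + n) : A' i j = A i j := by
  obtain ⟨R, hR⟩ := h
  simp only [reorient_lawrence] at hR
  let y : ℕ → ℤˣ := fun j => if h : j < n then if (⟨j, h⟩ : Fin n) ∈ R then -1 else 1 else 1
  have hy : ∀ (i : Fin r) (j : Fin n), negCols A R i j = y j * A i j := by
    intro i j
    simp only [negCols, y, j.2, dif_pos]
    split_ifs <;> simp
  have hu : ∀ u v : ℤˣ, u * v = 1 → v = u := by decide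
  have hconst : ∀ m ≤ r, y m = y 0 := by
    intro m
    induction m with
    | zero => exact fun _ => rfl
    | succ m ih =>
      intro hm
      have := mul_eq_mul_of_lawrence_eq hR ⟨m, hm⟩ (j := ⟨m, by omega⟩) (j' := ⟨m + 1, by omega⟩)
        le_rfl (by simp [Fin.lt_def]) (by simp only; omega)
      rw [hy, hy, hA.diag _ _ rfl, hA.super _ _ rfl, hA'.diag _ _ rfl, hA'.super _ _ rfl,
        mul_one, mul_one, mul_one] at this
      rw [hu _ _ this, ih (by omega)]
  have hr : 0 < r := (Nat.zero_le _).trans_lt i.2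
  have hconst' : ∀ j : Fin n, y j = y 0 := by
    intro j
    by_cases hj : j.val ≤ r
    · exact hconst _ hj
    · have := mul_eq_mul_of_lawrence_eq hR ⟨r - 1, by omega⟩ (j := ⟨r - 1, by omega⟩) (j' := j)
        le_rfl (by rw [Fin.lt_def]; simp only; omega) (by simp only; omega)
      rw [hy, hy, hA.diag _ _ rfl, hA.last _ j (by simp only; omega) (by simp only; omega),
        hA'.diag _ _ rfl, hA'.last _ j (by simp only; omega) (by simp only; omega),
        mul_one, mul_one, mul_one] at this
      rw [hu _ _ this]
      exact hconst (r - 1) (by omega)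
  rcases Nat.eq_or_lt_of_le h1 with h3 | h3
  · rw [hA.diag _ _ h3.symm, hA'.diag _ _ h3.symm]
  · have := mul_eq_mul_of_lawrence_eq hR i (j := ⟨i, by omega⟩) (j' := j) le_rfl
      (by rw [Fin.lt_def]; exact h3) h2
    rw [hy, hy, hconst', hconst', hA.diag _ _ rfl, hA'.diag _ _ rfl, mul_one, one_mul,
      ← mul_assoc, Int.units_mul_self, one_mul] at this
    exact this.symm

end Invariance

/-! ### Matrices in normal form as lists of bits -/

theorem testBit_lor_pow (v d d' : ℕ) :
    (Nat.lor v (Nat.pow 16 d)).testBit (4 * d') = (v.testBit (4 * d') || decide (d = d')) := by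
  change (v ||| 16 ^ d).testBit (4 * d') = _
  rw [Nat.testBit_or, show (16 : ℕ) = 2 ^ 4 from rfl, ← pow_mul, Nat.testBit_two_pow]
  congr 2
  rw [eq_iff_iff]
  omega

theorem fill_testBit_of_notMem {ds : List ℕ} {d : ℕ} (hd : d ∉ ds) (v : ℕ) (bs : List Bool) :
    (fill ds v bs).1.testBit (4 * d) = v.testBit (4 * d) := by
  induction ds generalizing v bs with
  | nil => rfl
  | cons e ds ih =>
    simp only [List.mem_cons, not_or] at hd
    match bs with
    | [] => rfl
    | false :: bs => exact ih hd.2 _ _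
    | true :: bs =>
      simp only [fill]
      rw [ih hd.2, testBit_lor_pow]
      simp [Ne.symm hd.1]

theorem exists_fill (ds : List ℕ) (β : ℕ → Bool) : ∃ bs : List Bool, bs.length = ds.length ∧
    ∀ (v : ℕ) (rest : List Bool), (fill ds v (bs ++ rest)).2 = rest ∧
      ∀ d, (fill ds v (bs ++ rest)).1.testBit (4 * d) =
        (v.testBit (4 * d) || (decide (d ∈ ds) && β d)) := by
  induction ds with
  | nil => exact ⟨[], rfl, fun v rest => ⟨rfl, fun d => by simp [fill]⟩⟩
  | cons e ds ih =>
    obtain ⟨bs, hl, h⟩ := ih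
    refine ⟨β e :: bs, by simp [hl], fun v rest => ?_⟩
    cases hb : β e
    · refine ⟨(h v rest).1, fun d => ?_⟩
      have := (h v rest).2 d
      simp only [List.cons_append, fill]
      rw [this]
      by_cases hd : d = e
      · subst hd; simp [hb]
      · simp [hd]
    · refine ⟨(h _ rest).1, fun d => ?_⟩
      have := (h (Nat.lor v (Nat.pow 16 e)) rest).2 d
      simp only [List.cons_append, fill]
      rw [this, testBit_lor_pow]
      by_cases hd : d = e
      · subst hd; simp [hb]
      · simp [hd, Ne.symm hd]

/-- The bits written into a letter can be read off from it. -/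
theorem eq_map_append_fill {ds : List ℕ} (hds : ds.Nodup) {v : ℕ}
    (hv : ∀ d ∈ ds, v.testBit (4 * d) = false) {bs : List Bool} (hbs : ds.length ≤ bs.length) :
    bs = ds.map (fun d => (fill ds v bs).1.testBit (4 * d)) ++ (fill ds v bs).2 := by
  induction ds generalizing v bs with
  | nil => rfl
  | cons e ds ih =>
    obtain ⟨he, hds⟩ := List.nodup_cons.1 hds
    match bs, hbs with
    | false :: bs, hbs =>
      simp only [fill, List.map_cons, List.cons_append]
      rw [fill_testBit_of_notMem he, hv e (by simp)]
      congr 1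
      exact ih hds (fun d hd => hv d (by simp [hd])) (by simpa using hbs)
    | true :: bs, hbs =>
      simp only [fill, List.map_cons, List.cons_append]
      rw [fill_testBit_of_notMem he, testBit_lor_pow]
      simp only [decide_true, Bool.or_true, List.cons.injEq, true_and]
      refine ih hds (fun d hd => ?_) (by simpa using hbs)
      rw [testBit_lor_pow, hv d (by simp [hd])]
      have : e ≠ d := fun h => he (h ▸ hd)
      simp [this]

theorem fill_snd_length {ds : List ℕ} {v : ℕ} {bs : List Bool} :
    (fill ds v bs).2.length = bs.length - ds.length := by
  induction ds generalizing v bs with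
  | nil => rfl
  | cons e ds ih =>
    match bs with
    | [] => simp [fill]
    | false :: bs => simp [fill, ih]
    | true :: bs => simp [fill, ih]

theorem fill_replicate_false (ds : List ℕ) (v m : ℕ) :
    fill ds v (List.replicate m false) = (v, List.replicate (m - ds.length) false) := by
  induction ds generalizing m with
  | nil => rfl
  | cons e ds ih =>
    cases m with
    | zero => simp [fill]
    | succ m => simp [List.replicate_succ, fill, ih]

theorem isLetter_lor : ∀ d, 1 ≤ d → d ≤ 3 → ∀ a b c : Bool,
    ∃ a' b' c' : Bool, Nat.lor (spread a b c) (Nat.pow 16 d) = spread a' b' c' := by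
  intro d h1 h2
  interval_cases d <;> decide +kernel

theorem isLetter_fill {ds : List ℕ} (hds : ∀ d ∈ ds, 1 ≤ d ∧ d ≤ 3) {v : ℕ} (hv : IsLetter v)
    (bs : List Bool) : IsLetter (fill ds v bs).1 := by
  induction ds generalizing v bs with
  | nil => exact hv
  | cons e ds ih =>
    match bs with
    | [] => exact hv
    | false :: bs => exact ih (fun d hd => hds d (by simp [hd])) hv _
    | true :: bs =>
      refine ih (fun d hd => hds d (by simp [hd])) ?_ _
      obtain ⟨a, b, c, rfl⟩ := hv
      exact isLetter_lor e (hds e (by simp)).1 (hds e (by simp)).2 a b c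

theorem isLetter_letters {cols : List (List ℕ)} (h : ∀ ds ∈ cols, ∀ d ∈ ds, 1 ≤ d ∧ d ≤ 3)
    (bs : List Bool) : ∀ v ∈ letters cols bs, IsLetter v := by
  induction cols generalizing bs with
  | nil => simp [letters]
  | cons ds cols ih =>
    simp only [letters, List.mem_cons, forall_eq_or_imp]
    exact ⟨isLetter_fill (h ds (by simp)) ⟨false, false, false, rfl⟩ _,
      ih (fun e he => h e (by simp [he])) _⟩

theorem length_letters (cols : List (List ℕ)) (bs : List Bool) :
    (letters cols bs).length = cols.length := by
  induction cols generalizing bs with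
  | nil => rfl
  | cons ds cols ih => simp [letters, ih]

theorem letters_testBit_of_notMem {cols : List (List ℕ)} (bs : List Bool) (j d : ℕ)
    (hd : d ∉ cols.getD j []) : ((letters cols bs).getD j 0).testBit (4 * d) = false := by
  induction cols generalizing bs j with
  | nil => simp [letters]
  | cons ds cols ih =>
    cases j with
    | zero =>
      simp only [List.getD_cons_zero] at hd
      simp [letters, fill_testBit_of_notMem hd]
    | succ j =>
      simp only [List.getD_cons_succ] at hd
      simpa [letters] using ih _ j hd

theorem exists_letters (cols : List (List ℕ)) (β : ℕ → ℕ → Bool) :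
    ∃ bs : List Bool, bs.length = (cols.map List.length).sum ∧
      ∀ j d, d ∈ cols.getD j [] → ((letters cols bs).getD j 0).testBit (4 * d) = β j d := by
  induction cols generalizing β with
  | nil => exact ⟨[], rfl, by simp⟩
  | cons ds cols ih =>
    obtain ⟨bs, hl, h⟩ := ih fun j => β (j + 1)
    obtain ⟨bs', hl', h'⟩ := exists_fill ds (β 0)
    obtain ⟨h1, h2⟩ := h' 0 bs
    refine ⟨bs' ++ bs, by simp [hl, hl'], fun j d hd => ?_⟩
    simp only [letters, h1]
    cases j with
    | zero =>
      simp only [List.getD_cons_zero] at hd ⊢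
      simp [h2, hd]
    | succ j =>
      simp only [List.getD_cons_succ] at hd ⊢
      exact h j d hd

theorem letters_injective {cols : List (List ℕ)} (hcols : ∀ ds ∈ cols, ds.Nodup)
    {bs bs' : List Bool} (hl : bs.length = (cols.map List.length).sum)
    (hl' : bs'.length = (cols.map List.length).sum)
    (h : ∀ j d, d ∈ cols.getD j [] → ((letters cols bs).getD j 0).testBit (4 * d) =
      ((letters cols bs').getD j 0).testBit (4 * d)) : bs = bs' := by
  induction cols generalizing bs bs' with
  | nil =>
    simp only [List.map_nil, List.sum_nil, List.length_eq_zero_iff] at hl hl'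
    rw [hl, hl']
  | cons ds cols ih =>
    simp only [List.map_cons, List.sum_cons] at hl hl'
    have hnd := hcols ds (by simp)
    rw [eq_map_append_fill hnd (v := 0) (by simp) (bs := bs) (by omega),
      eq_map_append_fill hnd (v := 0) (by simp) (bs := bs') (by omega)]
    congr 1
    · refine List.map_congr_left fun d hd => ?_
      simpa [letters] using h 0 d (by simpa using hd)
    · refine ih (fun e he => hcols e (by simp [he])) (by rw [fill_snd_length]; omega)
        (by rw [fill_snd_length]; omega) fun j d hd => ?_
      simpa [letters] using h (j + 1) d (by simpa using hd)

theorem letters_replicate_false (cols : List (List ℕ)) (m j : ℕ) :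
    (letters cols (List.replicate m false)).getD j 0 = 0 := by
  induction cols generalizing m j with
  | nil => simp [letters]
  | cons ds cols ih =>
    simp only [letters, fill_replicate_false]
    cases j with
    | zero => simp
    | succ j => simpa using ih _ j

/-- For each column `j` of an `r × (r + 1 + D)` matrix in normal form, the levels `d` whose entry, in
the row `j - d - 1`, is not prescribed. -/
def freeLevels (r D : ℕ) : List (List ℕ) :=
  (List.range (r + 1 + D)).map fun j =>
    ((List.range D).reverse.map Nat.succ).filter fun d => decide (d < j) && decide (j < d + r)

theorem mem_freeLevels {r D j d : ℕ} : d ∈ (freeLevels r D).getD j [] ↔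
    j < r + 1 + D ∧ 1 ≤ d ∧ d ≤ D ∧ d < j ∧ j < d + r := by
  by_cases hj : j < r + 1 + D
  · have : (freeLevels r D).getD j [] =
        ((List.range D).reverse.map Nat.succ).filter
          fun d => decide (d < j) && decide (j < d + r) := by
      simp [freeLevels, List.getD_eq_getElem?_getD, hj]
    rw [this, List.mem_filter, List.mem_map]
    simp only [List.mem_reverse, List.mem_range, Bool.and_eq_true, decide_eq_true_eq, hj, true_and]
    constructor
    · rintro ⟨⟨e, he, rfl⟩, h⟩
      exact ⟨Nat.succ_le_succ (Nat.zero_le _), he, h⟩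
    · rintro ⟨h1, h2, h3⟩
      exact ⟨⟨d - 1, by omega, by simp only [Nat.succ_eq_add_one]; omega⟩, h3⟩
  · simp [freeLevels, List.getD_eq_getElem?_getD, hj]

theorem nodup_freeLevels {r D : ℕ} : ∀ ds ∈ freeLevels r D, ds.Nodup := by
  intro ds hds
  obtain ⟨j, -, rfl⟩ := List.mem_map.1 hds
  exact (((List.nodup_reverse.2 List.nodup_range).map Nat.succ_injective)).filter _

theorem freeLevels_bounds {r D : ℕ} (hD : D < 4) : ∀ ds ∈ freeLevels r D, ∀ d ∈ ds,
    1 ≤ d ∧ d ≤ 3 := by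
  intro ds hds d hd
  obtain ⟨j, -, rfl⟩ := List.mem_map.1 hds
  obtain ⟨e, he, rfl⟩ := List.mem_map.1 (List.mem_filter.1 hd).1
  simp only [List.mem_reverse, List.mem_range] at he
  simp only [Nat.succ_eq_add_one]
  omega

/-- The sign matrix with the given letters: the entry `(i, j)` with `i < j` lies at level `j - i - 1`
of the column `j`, and the entries on and below the diagonal are `1`. -/
def matrixOf (r n : ℕ) (V : ℕ → ℕ) : Matrix (Fin r) (Fin n) ℤˣ :=
  fun i j => if i.val < j then boolSign ((V j).testBit (4 * (j - i - 1))) else 1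

/-- The letters of the matrix in normal form whose free entries are `bs`. -/
def boardLetters (r D : ℕ) (bs : List Bool) (j : ℕ) : ℕ := (letters (freeLevels r D) bs).getD j 0

/-- The matrix in normal form whose free entries are `bs`. -/
def boardMatrix (r D n : ℕ) (bs : List Bool) : Matrix (Fin r) (Fin n) ℤˣ :=
  matrixOf r n (boardLetters r D bs)

theorem boardLetters_testBit {r D : ℕ} (bs : List Bool) {j d : ℕ} (h : d = 0 ∨ j ≤ d ∨ d + r ≤ j) :
    (boardLetters r D bs j).testBit (4 * d) = false :=
  letters_testBit_of_notMem bs j d (by rw [mem_freeLevels]; omega)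

theorem isNormal_boardMatrix (r D n : ℕ) (bs : List Bool) : IsNormal (boardMatrix r D n bs) where
  diag i j h := by simp [boardMatrix, matrixOf, h]
  super i j h := by
    simp only [boardMatrix, matrixOf]
    rw [if_pos (by omega), boardLetters_testBit bs (by omega)]
    rfl
  last i j h h' := by
    simp only [boardMatrix, matrixOf]
    split_ifs
    · rw [boardLetters_testBit bs (by omega)]
      rfl
    · rfl

theorem testBit_sixteen_mul (v d : ℕ) :
    (16 * v).testBit (4 * d) = (decide (0 < d) && v.testBit (4 * (d - 1))) := by
  rw [show (16 : ℕ) = 2 ^ 4 from rfl, Nat.testBit_two_pow_mul]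
  rcases d with _ | d
  · simp
  · rw [show 4 * (d + 1) - 4 = 4 * (d + 1 - 1) by omega]
    simp

theorem codes_boardMatrix {r D n : ℕ} (bs : List Bool) :
    Codes D (boardLetters r D bs) (boardMatrix r D n bs) := by
  intro j d i hd hi hj
  constructor
  · cases i with
    | zero =>
      rw [boardLetters_testBit bs (by omega)]
      rfl
    | succ i =>
      rw [show i + 1 = (⟨i, hi⟩ : Fin r).val + 1 from rfl, entry_succ]
      simp only [boardMatrix, matrixOf]
      rw [if_pos (by omega), show j.val - i - 1 = d by omega]
  · rw [testBit_sixteen_mul]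
    rcases hi.eq_or_lt with rfl | hi
    · have : (decide (0 < d) && (boardLetters i D bs j).testBit (4 * (d - 1))) = false := by
        rcases Nat.eq_zero_or_pos d with rfl | h
        · rfl
        · rw [boardLetters_testBit bs (by omega), Bool.and_false]
      rw [this]
      simp [entry, boolSign]
    · rw [show i + 1 = (⟨i, hi⟩ : Fin r).val + 1 from rfl, entry_succ]
      simp only [boardMatrix, matrixOf]
      rcases Nat.eq_zero_or_pos d with rfl | h
      · rw [if_neg (by omega)]
        rfl
      · rw [if_pos (by omega), show j.val - i - 1 = d - 1 by omega]
        simp [h]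

/-- The number of free entries. -/
def numFree (r D : ℕ) : ℕ := ((freeLevels r D).map List.length).sum

section Boards

variable {r D n : ℕ}

theorem exists_board (hn : n = r + 1 + D) (A : Matrix (Fin r) (Fin n) ℤˣ) :
    ∃ (R : Finset (Fin n)) (bs : List Bool), bs.length = numFree r D ∧
      (lawrence A).reorient R = lawrence (boardMatrix r D n bs) := by
  obtain ⟨R, A', hA', hR⟩ := exists_isNormal A
  obtain ⟨bs, hl, h⟩ := exists_letters (freeLevels r D) fun j d =>
    if h : j - d - 1 < r ∧ j < n then decide (A' ⟨j - d - 1, h.1⟩ ⟨j, h.2⟩ = -1) else false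
  refine ⟨R, bs, hl, hR.trans (lawrence_eq_of_row_signs (fun _ => 1) fun i j h1 h2 => ?_)⟩
  rw [one_mul]
  have hB := isNormal_boardMatrix r D n bs
  have hi := i.2
  have hj := j.2
  by_cases e1 : j.val = i
  · rw [hB.diag i j e1, hA'.diag i j e1]
  by_cases e2 : j.val = i + 1
  · rw [hB.super i j e2, hA'.super i j e2]
  by_cases e3 : i.val + 1 = r
  · rw [hB.last i j e3 h1, hA'.last i j e3 h1]
  have hd := h j (j - i - 1) (by rw [mem_freeLevels]; omega)
  have e4 : j.val - (j - i - 1) - 1 = i := by omega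
  simp only [boardMatrix, matrixOf, boardLetters]
  rw [if_pos (by omega), hd, dif_pos ⟨by omega, hj⟩]
  have e5 : (⟨j.val - (j - i - 1) - 1, by omega⟩ : Fin r) = i := Fin.ext e4
  rw [e5]
  have key : ∀ u : ℤˣ, boolSign (decide (u = -1)) = u := by decide
  exact key _

theorem board_injective (hn : n = r + 1 + D) {bs bs' : List Bool} (hl : bs.length = numFree r D)
    (hl' : bs'.length = numFree r D)
    (h : lawrence (boardMatrix r D n bs') ∈ (lawrence (boardMatrix r D n bs)).reorientationClass) :
    bs = bs' := by
  refine letters_injective nodup_freeLevels hl hl' fun j d hd => ?_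
  rw [mem_freeLevels] at hd
  have := (isNormal_boardMatrix r D n bs).eq_of_mem_reorientationClass (by omega)
    (isNormal_boardMatrix r D n bs') h ⟨j - d - 1, by omega⟩ ⟨j, by omega⟩ (by simp only; omega)
    (by simp only; omega)
  simp only [boardMatrix, matrixOf] at this
  rw [if_pos (by omega), if_pos (by omega), show j - (j - d - 1) - 1 = d by omega] at this
  exact (boolSign_injective this).symm

theorem alternating_eq_board :
    alternating r n = lawrence (boardMatrix r D n (List.replicate (numFree r D) false)) := by
  have : boardMatrix r D n (List.replicate (numFree r D) false) = fun _ _ => 1 := by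
    funext i j
    simp only [boardMatrix, matrixOf, boardLetters, letters_replicate_false]
    simp [boolSign]
  rw [this]
  ext X
  change X ∈ alternatingCircuits r n ↔ _
  rw [alternatingCircuits_eq]
  rfl

/-- The initial state: level `0`, either carry, and every budget up to `k`. -/
def initState (k : ℕ) : ℕ := (2 ^ (k + 1) - 1) * 0x10001

theorem initState_testBit : ∀ k < 4, ∀ g, ∀ d < 4, ∀ t < 4,
    (initState k).testBit (pos g d t) = decide (d = 0 ∧ t ≤ k) := by
  decide +kernel

theorem fails_initState {k : ℕ} (hk : k < 4) (w : List (ℕ × Bool)) :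
    Fails D w (initState k) ↔ ∃ g, HasLightPath D w 0 g k := by
  constructor
  · rintro ⟨g, d, t, hd, ht, hS, h⟩
    rw [initState_testBit k hk g d hd t ht, decide_eq_true_eq] at hS
    obtain ⟨rfl, htk⟩ := hS
    exact ⟨g, h.mono htk⟩
  · rintro ⟨g, h⟩
    refine ⟨g, 0, k, by omega, hk, ?_, h⟩
    rw [initState_testBit k hk g 0 (by omega) k hk]
    simp

theorem length_freeLevels : (freeLevels r D).length = r + 1 + D := by simp [freeLevels]

theorem numNeighborly_board (hn : n = r + 1 + D) (hD : D < 4) {k : ℕ} (hk : k < 4)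
    (bs : List Bool) : (lawrence (boardMatrix r D n bs)).numNeighborly k =
      numGood D (letters (freeLevels r D) bs) (initState k) := by
  rw [numGood_eq_ncard hD (isLetter_letters (freeLevels_bounds hD) bs), numNeighborly,
    length_letters, length_freeLevels, ← hn]
  refine Set.ncard_congr (fun R _ => List.ofFn fun j => decide (j ∈ R)) ?_ ?_ ?_
  · intro R hR
    refine ⟨by simp, fun hF => ?_⟩
    rw [fails_initState hk] at hF
    refine (not_isNeighborly_reorient_iff hn (codes_boardMatrix bs) rfl R
      (fun j => if h : j < n then decide ((⟨j, h⟩ : Fin n) ∈ R) else false) (by simp) k).2 ?_ hR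
    convert hF using 4
    refine List.ext_getElem (by simp [length_letters, length_freeLevels, hn]) fun j h1 h2 => ?_
    have hj : j < n := by simpa using h1
    simp [boardLetters, hj, length_letters, length_freeLevels, ← hn]
  · intro R R' _ _ h
    ext j
    have := congrFun (List.ofFn_injective h) j
    simpa using this
  · rintro xs ⟨hl, hF⟩
    have hxs : (List.ofFn fun j : Fin n =>
        decide (j ∈ Finset.univ.filter fun j : Fin n => xs.getD j false = true)) = xs := by
      refine List.ext_getElem (by simp [hl]) fun j h1 h2 => ?_
      simp [h2]
    refine ⟨Finset.univ.filter fun j : Fin n => xs.getD j false = true, ?_, hxs⟩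
    by_contra hR
    refine hF ((fails_initState hk _).2 ?_)
    have := (not_isNeighborly_reorient_iff hn (codes_boardMatrix bs) rfl
      (Finset.univ.filter fun j : Fin n => xs.getD j false = true)
      (fun j => xs.getD j false) (by simp) k).1 hR
    convert this using 4
    refine List.ext_getElem (by simp [length_letters, length_freeLevels, hl, ← hn])
      fun j h1 h2 => ?_
    have hj : j < n := by simpa using h2
    simp [boardLetters, hj, hl, length_letters, length_freeLevels, ← hn]

end Boards

/-! ### The four cases -/

/-- The numbers of `k`-neighborly reorientations of all matrices in normal form with `8` rows are
packed, and it is checked that the one of the matrix with constant entries is `c`, that none exceeds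
`c`, and that exactly `N` are equal to `c`. -/
def packedTest (D k c N : ℕ) : Bool :=
  maxTest (7 * D) c N (force id (packedCount D (freeLevels 8 D) (initState k)))

theorem packedTest_two_two : packedTest 2 2 462 256 = true := by decide +kernel

theorem packedTest_two_three : packedTest 2 3 22 256 = true := by decide +kernel

theorem packedTest_three_two : packedTest 3 2 488 512 = true := by decide +kernel

theorem packedTest_three_three : packedTest 3 3 24 512 = true := by decide +kernel

/-- The constant matrix, coded by the list without `true`, belongs to the alternating oriented matroid
and is the one of the `N` maximizers that is not counted. -/
theorem numNeighborly_le_and_ncard_equalityClasses {D k c N n : ℕ} (hn : n = 8 + 1 + D)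
    (hD : D < 4) (hk : k < 4) (hc : c ≤ 2 ^ 12) (hfree : numFree 8 D = 7 * D)
    (h : packedTest D k c N = true) :
    (∀ M : OrientedMatroid (Fin n), IsLawrence 8 M →
      M ∉ (alternating 8 n).reorientationClass → M.numNeighborly k ≤ alternatingCount 8 n k) ∧
    (equalityClasses 8 n k).ncard = N - 1 := by
  let F : List Bool → ℕ := fun bs => numGood D (letters (freeLevels 8 D) bs) (initState k)
  have hF : ∀ bs, (lawrence (boardMatrix 8 D n bs)).numNeighborly k = F bs :=
    numNeighborly_board hn hD hk
  rw [packedTest, force_eq, id, packedCount_eq] at h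
  change maxTest (7 * D) c N (pack (numFree 8 D) F) = true at h
  rw [hfree] at h
  obtain ⟨h0, hle, hN⟩ := maxTest_sound (fun bs _ => by
    refine (numGood_le D _ _).trans (Nat.pow_le_pow_right (by norm_num) ?_)
    rw [length_letters, length_freeLevels]
    omega) hc h
  have halt : alternating 8 n =
      lawrence (boardMatrix 8 D n (List.replicate (7 * D) false)) := by
    rw [← hfree]
    exact alternating_eq_board
  have hcount : alternatingCount 8 n k = c := by rw [alternatingCount, halt, hF, h0]
  -- Every Lawrence oriented matroid is a reorientation of that of a matrix in normal form.
  have hboard : ∀ M : OrientedMatroid (Fin n), IsLawrence 8 M → ∃ bs : List Bool,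
      bs.length = 7 * D ∧ M.numNeighborly k = F bs ∧
        M.reorientationClass = (lawrence (boardMatrix 8 D n bs)).reorientationClass := by
    rintro M ⟨A, rfl⟩
    obtain ⟨R, bs, hl, hR⟩ := exists_board hn A
    refine ⟨bs, hl.trans hfree, ?_, ?_⟩
    · rw [← hF, ← hR, numNeighborly_reorient]
    · rw [← hR, reorientationClass_reorient]
  have hinj : ∀ bs bs' : List Bool, bs.length = 7 * D → bs'.length = 7 * D →
      (lawrence (boardMatrix 8 D n bs)).reorientationClass =
        (lawrence (boardMatrix 8 D n bs')).reorientationClass → bs = bs' := by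
    intro bs bs' hl hl' he
    refine board_injective hn (hl.trans hfree.symm) (hl'.trans hfree.symm) ?_
    rw [he]
    exact mem_reorientationClass_self _
  refine ⟨fun M hM _ => ?_, ?_⟩
  · obtain ⟨bs, hl, hMF, -⟩ := hboard M hM
    rw [hMF, hcount]
    exact hle bs hl
  · have himage : equalityClasses 8 n k =
        (fun bs => (lawrence (boardMatrix 8 D n bs)).reorientationClass) ''
          ({bs : List Bool | bs.length = 7 * D ∧ F bs = c} \ {List.replicate (7 * D) false}) := by
      ext C
      constructor
      · rintro ⟨M, hM, hne, hMk, rfl⟩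
        obtain ⟨bs, hl, hMF, hcl⟩ := hboard M hM
        refine ⟨bs, ⟨⟨hl, by rw [← hMF, hMk, hcount]⟩, ?_⟩, hcl.symm⟩
        rintro rfl
        rw [halt, ← hcl] at hne
        exact hne (mem_reorientationClass_self M)
      · rintro ⟨bs, ⟨⟨hl, hc⟩, hne⟩, rfl⟩
        refine ⟨_, ⟨_, rfl⟩, fun hmem => hne ?_, by rw [hF, hc, hcount], rfl⟩
        obtain ⟨R, hR⟩ := hmem
        rw [halt] at hR
        refine hinj _ _ hl (by simp) ?_
        rw [← hR, reorientationClass_reorient]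
    have hmem : List.replicate (7 * D) false ∈ {bs : List Bool | bs.length = 7 * D ∧ F bs = c} :=
      ⟨by simp, h0⟩
    rw [himage, Set.InjOn.ncard_image fun bs hbs bs' hbs' he => hinj bs bs' hbs.1.1 hbs'.1.1 he,
      Set.ncard_sdiff_singleton_of_mem hmem, hN]

end OrientedMatroid

theorem mainTheorem9 :
    ((∀ M : OrientedMatroid (Fin 11), OrientedMatroid.IsLawrence 8 M →
        M ∉ (OrientedMatroid.alternating 8 11).reorientationClass →
        M.numNeighborly 2 ≤ OrientedMatroid.alternatingCount 8 11 2) ∧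
      (OrientedMatroid.equalityClasses 8 11 2).ncard = 255) ∧
    ((∀ M : OrientedMatroid (Fin 11), OrientedMatroid.IsLawrence 8 M →
        M ∉ (OrientedMatroid.alternating 8 11).reorientationClass →
        M.numNeighborly 3 ≤ OrientedMatroid.alternatingCount 8 11 3) ∧
      (OrientedMatroid.equalityClasses 8 11 3).ncard = 255) ∧
    ((∀ M : OrientedMatroid (Fin 12), OrientedMatroid.IsLawrence 8 M →
        M ∉ (OrientedMatroid.alternating 8 12).reorientationClass →
        M.numNeighborly 2 ≤ OrientedMatroid.alternatingCount 8 12 2) ∧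
      (OrientedMatroid.equalityClasses 8 12 2).ncard = 511) ∧
    ((∀ M : OrientedMatroid (Fin 12), OrientedMatroid.IsLawrence 8 M →
        M ∉ (OrientedMatroid.alternating 8 12).reorientationClass →
        M.numNeighborly 3 ≤ OrientedMatroid.alternatingCount 8 12 3) ∧
      (OrientedMatroid.equalityClasses 8 12 3).ncard = 511) := by
  have h2 : OrientedMatroid.numFree 8 2 = 7 * 2 := by decide +kernel
  have h3 : OrientedMatroid.numFree 8 3 = 7 * 3 := by decide +kernel
  exact ⟨OrientedMatroid.numNeighborly_le_and_ncard_equalityClasses rfl (by norm_num) (by norm_num)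
      (by norm_num) h2 OrientedMatroid.packedTest_two_two,
    OrientedMatroid.numNeighborly_le_and_ncard_equalityClasses rfl (by norm_num) (by norm_num)
      (by norm_num) h2 OrientedMatroid.packedTest_two_three,
    OrientedMatroid.numNeighborly_le_and_ncard_equalityClasses rfl (by norm_num) (by norm_num)
      (by norm_num) h3 OrientedMatroid.packedTest_three_two,
    OrientedMatroid.numNeighborly_le_and_ncard_equalityClasses rfl (by norm_num) (by norm_num)
      (by norm_num) h3 OrientedMatroid.packedTest_three_three⟩
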